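/- Let $p\ge 0$ be an integer. Equip $SO(p)$ with the bi-invariant Riemannian metric given at the identity by $\langle A_1,A_2\rangle=-\tfrac12\operatorname{tr}(A_1A_2)$ for antisymmetric $A_1,A_2$, and let $d_{SO}$ be the associated geodesic distance. Call a pair $(U,V)\in SO(p)\times SO(p)$ geodesically antipodal if one of $U,V$ lies in the cut-locus of the other. (The cut-locus of $U$ is the set of all points $\gamma(t_0)$, where $\gamma:\mathbb{R}\to SO(p)$ is a unit-speed geodesic with $\gamma(0)=U$ and $t_0=\sup\{t>0 : d_{SO}(U,\gamma(t))=t\}$.) An even sign-change matrix is a diagonal matrix $I_\sigma=\operatorname{diag}(\sigma_1,\dots,\sigma_p)$ with all $\sigma_i\in\{1,-1\}$ and $\det I_\sigma=1$. Call $(U,V)$ sign-change reducible if $d_{SO}(UI_\sigma,V)<d_{SO}(U,V)$ for some even sign-change matrix $I_\sigma$. (a) If $p\le 4$, then every geodesically antipodal pair $(U,V)$ in $SO(p)\times SO(p)$ is sign-change reducible. (b) If $p\ge 11$, then there exists a geodesically antipodal pair $(U,V)$ in $SO(p)\times SO(p)$ that is not sign-change reducible. -/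

import Mathlib

open scoped Matrix

namespace SignChange

noncomputable section

open scoped Matrix.Norms.Frobenius

/-- The rotation group `SO(p)`. -/
abbrev SO (p : ℕ) : Type := Matrix.specialOrthogonalGroup (Fin p) ℝ

/-- Half the Frobenius inner product of two `p × p` matrices. Its restriction to the tangent spaces
`T_U SO(p) = {A * U | Aᵀ = -A}` is the bi-invariant Riemannian metric of `SO(p)` that is given
by `-tr (A₁ A₂) / 2` at the identity; see `metric_tangent`. -/
def metric {p : ℕ} (X Y : Matrix (Fin p) (Fin p) ℝ) : ℝ :=
  (1 / 2) * (Xᵀ * Y).trace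

theorem metric_tangent {p : ℕ} (U : SO p) (A₁ A₂ : Matrix (Fin p) (Fin p) ℝ)
    (h₁ : A₁ᵀ = -A₁) :
    metric (A₁ * (U : Matrix (Fin p) (Fin p) ℝ)) (A₂ * (U : Matrix (Fin p) (Fin p) ℝ))
      = -(1 / 2) * (A₁ * A₂).trace := by
  have hU : (U : Matrix (Fin p) (Fin p) ℝ) * (U : Matrix (Fin p) (Fin p) ℝ)ᵀ = 1 :=
    (Matrix.mem_orthogonalGroup_iff (Fin p) ℝ).1
      (Matrix.mem_specialOrthogonalGroup_iff.1 U.2).1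
  unfold metric
  rw [Matrix.transpose_mul, h₁, Matrix.mul_assoc, Matrix.trace_mul_comm, Matrix.mul_assoc,
    Matrix.mul_assoc, hU, Matrix.mul_one, Matrix.neg_mul, Matrix.trace_neg]
  ring

/-- A curve in `SO(p)`, viewed as a curve of matrices. -/
def toCurve {p : ℕ} (γ : ℝ → SO p) (t : ℝ) : Matrix (Fin p) (Fin p) ℝ := (γ t).1

/-- The Riemannian length of the restriction to `[0, 1]` of a curve in `SO(p)`. -/
def length {p : ℕ} (γ : ℝ → SO p) : ℝ :=
  ∫ t in (0 : ℝ)..1, √(metric (derivWithin (toCurve γ) (Set.Icc 0 1) t)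
    (derivWithin (toCurve γ) (Set.Icc 0 1) t))

/-- The Riemannian distance `d_SO(U, V)`: the infimum of the lengths of the `C¹` curves
`[0, 1] → SO(p)` from `U` to `V`. -/
def dist {p : ℕ} (U V : SO p) : ℝ :=
  sInf {L : ℝ | ∃ γ : ℝ → SO p, ContDiffOn ℝ 1 (toCurve γ) (Set.Icc 0 1) ∧
    γ 0 = U ∧ γ 1 = V ∧ L = length γ}

/-- A unit-speed geodesic `ℝ → SO(p)`: a smooth curve whose velocity has length one and whose
covariant acceleration, that is, the orthogonal projection of its second derivative to the tangent
space `T_{γ t} SO(p) = {A * γ t | Aᵀ = -A}`, is zero. -/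
structure IsUnitGeodesic {p : ℕ} (γ : ℝ → SO p) : Prop where
  smooth : ContDiff ℝ (⊤ : ℕ∞) (toCurve γ)
  unit_speed : ∀ t, metric (deriv (toCurve γ) t) (deriv (toCurve γ) t) = 1
  acceleration : ∀ t, ∀ A : Matrix (Fin p) (Fin p) ℝ, Aᵀ = -A →
    metric (deriv (deriv (toCurve γ)) t) (A * toCurve γ t) = 0

/-- The cut-locus of `U`: the points `γ t₀` where `γ` is a unit-speed geodesic from `U` and `t₀` is
the last time up to which `γ` is minimizing. -/
def cutLocus {p : ℕ} (U : SO p) : Set (SO p) :=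
  {V | ∃ (γ : ℝ → SO p) (t₀ : ℝ), IsUnitGeodesic γ ∧ γ 0 = U ∧
    IsLUB {t : ℝ | 0 < t ∧ dist U (γ t) = t} t₀ ∧ γ t₀ = V}

/-- One point of the pair is in the cut-locus of the other. -/
def GeodesicallyAntipodal {p : ℕ} (U V : SO p) : Prop :=
  V ∈ cutLocus U ∨ U ∈ cutLocus V

/-- The even sign-change matrices: the diagonal matrices with diagonal entries `±1` that lie in
`SO(p)`. -/
def evenSignChanges (p : ℕ) : Set (SO p) :=
  {S | ∃ σ : Fin p → ℝ, (∀ i, σ i = 1 ∨ σ i = -1) ∧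
    (S : Matrix (Fin p) (Fin p) ℝ) = Matrix.diagonal σ}

/-- Multiplying `U` by some even sign-change matrix brings it closer to `V`. -/
def SignChangeReducible {p : ℕ} (U V : SO p) : Prop :=
  ∃ S ∈ evenSignChanges p, dist (U * S) V < dist U V

end

end SignChange

/-! Everything rests on computing enough of `dist`. Upper bounds come from the curves `U exp (tA)`:
if `Uᵀ V = exp B` with `B` antisymmetric, then `dist U V ^ 2 ≤ metric B B` (`dist_le_of_exp`). For
lower bounds, the squared distance from the identity should be half the sum of `θ ^ 2` over the
rotation angles of `W = Uᵀ V`, that is, half the trace of `f (chord W)`, where `f u = arccos (1 - u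
/ 2) ^ 2`. The power series of `f` has nonnegative coefficients, and each truncation satisfies the
eikonal inequality `u (4 - u) f' ^ 2 ≤ 4 f` coefficientwise. Hence the square root of the truncated
trace is 1-Lipschitz along curves (`sqrt_sqDistTrunc_le_length`) and bounds the distance from below;
letting the order tend to infinity gives sharp bounds where needed. This needs neither a logarithm
of orthogonal matrices nor the existence of minimizing geodesics.

Unit-speed geodesics are the curves `U exp (tA)` with `metric A A = 1`
(`IsUnitGeodesic.eq_expCurve`), and the bounds above determine their cut times in the cases that
matter. If `A ^ 3 = -A`, a rotation in one plane, the cut time is `π`.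

For (a), `p < 2` admits no unit-speed geodesic. For `p = 2`, antipodal means `V = -U`, and `-1` is
an even sign change. For `p = 3`, `Uᵀ V` is a half-turn about some axis; composing it with the
half-turn about a coordinate axis not orthogonal to it leaves a rotation by less than `π`. For `p =
4`, an antisymmetric matrix splits into commuting left and right quaternion multiplications, so that
`Uᵀ V = exp (aL + bR)` with `a, b ≥ 0` and `a + b = π` at the cut point. If `a ≠ b`, the sign change
`-1` shortens the larger of the two; if `a = b`, the sign changes `q ↦ ± e q e` with a coordinate
unit `e` do the job (`reducible_four`).

For (b), take `U = 1` and let `V` be the half-turn in a plane equally inclined to all coordinate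
axes, so that `dist U V = π`. For a nontrivial even sign change, the chord matrix is four times the
squared difference of two projections, with known trace and bounded rank. Jensen's inequality for
the truncation of order 6 then gives a squared distance above `π ^ 2` (`pi_sq_lt_sqDistTrunc`). -/

namespace SignChange

/-! ### Truncated power series of the squared arccosine. -/

open Polynomial in
/-- Truncations of the power series of `arccos (1 - u / 2) ^ 2` at `u = 0`. -/
noncomputable def arccosSq (N : ℕ) : ℝ[X] :=
  -- The term `n = 0` is a division by zero, hence `0`, as it should be.
  ∑ n ∈ Finset.range (N + 1), C (2 / ((n : ℝ) ^ 2 * n.centralBinom)) * X ^ n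

open Polynomial in
theorem arccosSq_succ (N : ℕ) : arccosSq (N + 1) = arccosSq N +
    C (2 / (((N + 1 : ℕ) : ℝ) ^ 2 * (N + 1).centralBinom)) * X ^ (N + 1) := by
  rw [arccosSq, Finset.sum_range_succ, ← arccosSq]

open Polynomial in
theorem arccosSq_zero : arccosSq 0 = 0 := by simp [arccosSq]

theorem arccosSq_coeff_nonneg (N k : ℕ) : 0 ≤ (arccosSq N).coeff k := by
  rw [arccosSq, Polynomial.finsetSum_coeff]
  refine Finset.sum_nonneg fun n _ => ?_
  rw [Polynomial.coeff_C_mul_X_pow]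
  split_ifs <;> positivity

theorem arccosSq_coeff_zero (N : ℕ) : (arccosSq N).coeff 0 = 0 := by
  induction N with
  | zero => simp [arccosSq_zero]
  | succ N ih => rw [arccosSq_succ, Polynomial.coeff_add, ih]; simp

open Polynomial in
/-- The differential equation satisfied by `arccosSq` up to a term of top degree. -/
theorem arccosSq_ode (N : ℕ) :
    X * (4 - X) * derivative (derivative (arccosSq N)) + (2 - X) * derivative (arccosSq N)
      = 2 - C (2 / (N.centralBinom : ℝ)) * X ^ N := by
  induction N with
  | zero =>
    simp only [arccosSq_zero, derivative_zero, mul_zero, add_zero, Nat.centralBinom_zero,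
      Nat.cast_one, div_one, pow_zero, mul_one]
    rw [show (C (2 : ℝ)) = 2 from rfl, sub_self]
  | succ N ih =>
    have hc : ((N + 1 : ℕ) : ℝ) * (N + 1).centralBinom = 2 * (2 * N + 1) * N.centralBinom := by
      exact_mod_cast Nat.succ_mul_centralBinom_succ N
    have h0 : (N.centralBinom : ℝ) ≠ 0 := by exact_mod_cast N.centralBinom_ne_zero
    have h1 : ((N + 1).centralBinom : ℝ) ≠ 0 := by exact_mod_cast (N + 1).centralBinom_ne_zero
    have hN : ((N + 1 : ℕ) : ℝ) ≠ 0 := by positivity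
    set a : ℝ := 2 / (((N + 1 : ℕ) : ℝ) ^ 2 * (N + 1).centralBinom) with ha
    -- The new term `a X^(N+1)` contributes `2a(N+1)(2N+1) X^N`, which cancels the old error by
    -- `e1`, and `-a(N+1)^2 X^(N+1)`, which is the new error by `e2`.
    have e1 : a * (2 * ((N : ℝ) + 1) * (2 * N + 1)) = 2 / N.centralBinom := by
      rw [ha, div_mul_eq_mul_div, div_eq_div_iff (by positivity) h0]
      push_cast at hc ⊢
      linear_combination -2 * ((N : ℝ) + 1) * hc
    have e2 : a * ((N : ℝ) + 1) ^ 2 = 2 / (N + 1).centralBinom := by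
      rw [ha]; push_cast; field_simp
    rw [arccosSq_succ, ← ha, ← e2]
    rw [← e1] at ih
    have hX : (X : ℝ[X]) * derivative (derivative (C a * X ^ (N + 1)))
        = C (a * ((N + 1) * N)) * X ^ N := by
      rw [derivative_C_mul_X_pow, derivative_C_mul_X_pow]
      rcases N with _ | N
      · simp
      · simp only [Nat.add_sub_cancel]; push_cast; simp only [map_mul, map_add]; ring
    have hX' : derivative (C a * X ^ (N + 1)) = C (a * (N + 1)) * X ^ N := by
      rw [derivative_C_mul_X_pow]; push_cast; simp
    rw [derivative_add, derivative_add]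
    rw [hX'] at hX ⊢
    have hx : X * (4 - X) * derivative (C (a * (N + 1)) * X ^ N)
        = (4 - X) * (C (a * ((N + 1) * N)) * X ^ N) := by rw [← hX]; ring
    have h2 : (2 : ℝ[X]) = C 2 := rfl
    have h1' : (1 : ℝ[X]) = C 1 := rfl
    rw [mul_add, hx]
    simp only [map_mul, map_add, map_pow, ← h2, ← h1'] at ih ⊢
    linear_combination ih

open Polynomial in
/-- The function `arccosSq N` is dominated by the square of the Riemannian distance in the
differential sense, with a coefficientwise nonnegative defect. -/
theorem arccosSq_defect_coeff_nonneg (N k : ℕ) :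
    0 ≤ (4 * arccosSq N - X * (4 - X) * derivative (arccosSq N) ^ 2).coeff k := by
  rcases k with _ | k
  · have h0 := arccosSq_coeff_zero N
    rw [coeff_zero_eq_eval_zero] at h0 ⊢
    simp [h0]
  · have h := arccosSq_ode N
    set G := arccosSq N with hG
    -- By the differential equation, the derivative of the defect collapses to `G'` times the error
    -- monomial; its coefficients are visibly nonnegative, and the defect has no constant term.
    have hd : derivative (4 * G - X * (4 - X) * derivative G ^ 2)
        = derivative G * (C (2 * (2 / (N.centralBinom : ℝ))) * X ^ N) := by
      have h2 : (2 : ℝ[X]) = C 2 := rfl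
      have h4 : derivative (4 : ℝ[X]) = 0 := by
        rw [show (4 : ℝ[X]) = C 4 from rfl, derivative_C]
      rw [derivative_sub, derivative_mul, derivative_mul, derivative_mul, derivative_pow,
        derivative_sub, h4, derivative_X]
      rw [map_mul, ← h2]
      norm_num
      rw [← h2]
      linear_combination (-2 * derivative G) * h
    have hc := congrArg (fun q => coeff q k) hd
    simp only [coeff_derivative] at hc
    have : 0 ≤ (derivative G * (C (2 * (2 / (N.centralBinom : ℝ))) * X ^ N)).coeff k := by
      rw [mul_left_comm, coeff_C_mul, coeff_mul_X_pow', ]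
      split_ifs
      · rw [coeff_derivative]
        have := arccosSq_coeff_nonneg N (k - N + 1)
        positivity
      · simp
    rw [← hc] at this
    exact nonneg_of_mul_nonneg_left this (by positivity)

theorem eval_nonneg_of_coeff_nonneg {p : Polynomial ℝ} (hp : ∀ k, 0 ≤ p.coeff k) {u : ℝ}
    (hu : 0 ≤ u) : 0 ≤ p.eval u := by
  rw [Polynomial.eval_eq_sum_range]
  exact Finset.sum_nonneg fun n _ => mul_nonneg (hp n) (pow_nonneg hu n)

theorem eval_mono_of_coeff_nonneg {p : Polynomial ℝ} (hp : ∀ k, 0 ≤ p.coeff k) {u v : ℝ}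
    (hu : 0 ≤ u) (huv : u ≤ v) : p.eval u ≤ p.eval v := by
  rw [Polynomial.eval_eq_sum_range, Polynomial.eval_eq_sum_range]
  exact Finset.sum_le_sum fun n _ => mul_le_mul_of_nonneg_left (pow_le_pow_left₀ hu huv n) (hp n)

/-- Comparison on an interval on which `1 - cos` is bounded. -/
theorem sq_mul_le_arccosSq (N : ℕ) {θ ε : ℝ}
    (hε : ∀ x ∈ Set.Icc 0 θ, 2 / (N.centralBinom : ℝ) * (2 - 2 * Real.cos x) ^ N ≤ ε)
    (hθ : 0 ≤ θ) : (1 - ε / 2) * θ ^ 2 ≤ (arccosSq N).eval (2 - 2 * Real.cos θ) := by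
  set G := arccosSq N with hG
  have hu : ∀ x : ℝ, HasDerivAt (fun x => 2 - 2 * Real.cos x) (2 * Real.sin x) x := fun x => by
    have := ((Real.hasDerivAt_cos x).const_mul 2).const_sub 2
    simpa using this
  have hg : ∀ x : ℝ, HasDerivAt (fun x => G.eval (2 - 2 * Real.cos x))
      (G.derivative.eval (2 - 2 * Real.cos x) * (2 * Real.sin x)) x := fun x =>
    (G.hasDerivAt _).comp x (hu x)
  -- In the variable `x` with `u = 2 - 2 cos x`, the differential equation says that the second
  -- derivative is `2` minus the error; two integrations from `0` finish.
  have hg' : ∀ x : ℝ, HasDerivAt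
      (fun x => G.derivative.eval (2 - 2 * Real.cos x) * (2 * Real.sin x))
      (2 - 2 / (N.centralBinom : ℝ) * (2 - 2 * Real.cos x) ^ N) x := fun x => by
    have h := (((G.derivative.hasDerivAt _).comp x (hu x))).mul
      ((Real.hasDerivAt_sin x).const_mul 2)
    refine HasDerivAt.congr_deriv h ?_
    have o := congrArg (Polynomial.eval (2 - 2 * Real.cos x)) (arccosSq_ode N)
    simp only [Polynomial.eval_add, Polynomial.eval_mul, Polynomial.eval_sub, Polynomial.eval_X,
      Polynomial.eval_C, Polynomial.eval_pow, Polynomial.eval_ofNat] at o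
    rw [← hG] at o
    rw [← o]
    simp only [Function.comp_apply]
    have hs := Real.sin_sq_add_cos_sq x
    linear_combination (4 * Polynomial.eval (2 - 2 * Real.cos x) G.derivative.derivative) * hs
  have key1 : ∀ x ∈ Set.Icc 0 θ, (2 - ε) * x ≤
      G.derivative.eval (2 - 2 * Real.cos x) * (2 * Real.sin x) := by
    have hm : MonotoneOn (fun x => G.derivative.eval (2 - 2 * Real.cos x) * (2 * Real.sin x)
        - (2 - ε) * x) (Set.Icc 0 θ) := by
      refine monotoneOn_of_hasDerivWithinAt_nonneg (convex_Icc 0 θ) (fun x _ =>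
        ((hg' x).sub ((hasDerivAt_id x).const_mul (2 - ε))).continuousAt.continuousWithinAt)
        (fun x _ => ((hg' x).sub ((hasDerivAt_id x).const_mul (2 - ε))).hasDerivWithinAt)
        fun x hx => ?_
      have := hε x (interior_subset hx)
      linarith
    intro x hx
    have := hm (Set.left_mem_Icc.2 hθ) hx hx.1
    simp at this
    linarith
  have hm : MonotoneOn (fun x => G.eval (2 - 2 * Real.cos x) - (1 - ε / 2) * x ^ 2)
      (Set.Icc 0 θ) := by
    refine monotoneOn_of_hasDerivWithinAt_nonneg (convex_Icc 0 θ) (fun x _ =>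
      ((hg x).sub ((hasDerivAt_pow 2 x).const_mul (1 - ε / 2))).continuousAt.continuousWithinAt)
      (fun x _ => ((hg x).sub ((hasDerivAt_pow 2 x).const_mul (1 - ε / 2))).hasDerivWithinAt)
      fun x hx => ?_
    have := key1 x (interior_subset hx)
    norm_num
    linarith
  have := hm (Set.left_mem_Icc.2 hθ) (Set.right_mem_Icc.2 hθ) hθ
  simp [← Polynomial.coeff_zero_eq_eval_zero, hG, arccosSq_coeff_zero] at this
  linarith

-- For angles below `π` the error of the differential equation tends to `0` uniformly on the
-- interval. At `π` itself that error estimate fails, and the bound follows by continuity from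
-- smaller angles.
open Filter Topology in
theorem sq_le_of_arccosSq_le {θ c : ℝ} (h0 : 0 ≤ θ) (hπ : θ ≤ Real.pi)
    (h : ∀ N, (arccosSq N).eval (2 - 2 * Real.cos θ) ≤ c) : θ ^ 2 ≤ c := by
  have main : ∀ x, 0 ≤ x → x < Real.pi → x ≤ θ → x ^ 2 ≤ c := by
    intro x hx0 hx hxθ
    set q : ℝ := (2 - 2 * Real.cos x) / 4 with hq
    have hcos : -1 < Real.cos x := by
      rw [← Real.cos_pi]
      exact Real.cos_lt_cos_of_nonneg_of_le_pi hx0 le_rfl hx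
    have hq0 : 0 ≤ q := by have := Real.cos_le_one x; rw [hq]; linarith
    have hq1 : q < 1 := by rw [hq]; linarith
    have hlim : Tendsto (fun N : ℕ => (1 - (4 * ((N : ℝ) * q ^ N)) / 2) * x ^ 2) atTop
        (𝓝 ((1 - (4 * 0) / 2) * x ^ 2)) :=
      (((((tendsto_self_mul_const_pow_of_lt_one hq0 hq1).const_mul 4).div_const 2).const_sub
        1).mul_const _)
    have hle : (1 - (4 * (0 : ℝ)) / 2) * x ^ 2 ≤ c := by
      refine le_of_tendsto hlim ?_
      filter_upwards [eventually_gt_atTop 0] with N hN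
      refine (sq_mul_le_arccosSq N ?_ hx0).trans ((eval_mono_of_coeff_nonneg
        (arccosSq_coeff_nonneg N) ?_ ?_).trans (h N))
      · intro y hy
        have hy1 : Real.cos x ≤ Real.cos y :=
          Real.cos_le_cos_of_nonneg_of_le_pi hy.1 hx.le hy.2
        have hy2 := Real.cos_le_one y
        -- This bounds the error `2 (4q)^N / centralBinom N` by `4 N q^N`.
        have h4 : (4 : ℝ) ^ N ≤ 2 * N * N.centralBinom := by
          exact_mod_cast Nat.four_pow_le_two_mul_self_mul_centralBinom N hN
        have hc : (0 : ℝ) < N.centralBinom := by exact_mod_cast N.centralBinom_pos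
        rw [div_mul_eq_mul_div, div_le_iff₀ hc]
        have hp : (2 - 2 * Real.cos y) ^ N ≤ (4 * q) ^ N :=
          pow_le_pow_left₀ (by linarith) (by rw [hq]; linarith) N
        rw [mul_pow] at hp
        have := mul_le_mul_of_nonneg_right h4 (pow_nonneg hq0 N)
        nlinarith
      · linarith [Real.cos_le_one x]
      · have := Real.cos_le_cos_of_nonneg_of_le_pi hx0 hπ hxθ
        linarith
    simpa using hle
  rcases hπ.lt_or_eq with hlt | rfl
  · exact main θ h0 hlt le_rfl
  · have hlim : Tendsto (fun x : ℝ => x ^ 2) (𝓝[<] Real.pi) (𝓝 (Real.pi ^ 2)) :=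
      ((continuous_pow 2).tendsto _).mono_left nhdsWithin_le_nhds
    refine le_of_tendsto hlim ?_
    filter_upwards [Ioo_mem_nhdsLT Real.pi_pos] with x hx
    exact main x hx.1.le hx.2 hx.2.le

open scoped Matrix.Norms.Frobenius

/-! ### Trace inequalities and the gradient estimate. -/

section TraceInequalities

variable {p : ℕ}

theorem trace_transpose_mul_self_nonneg (A : Matrix (Fin p) (Fin p) ℝ) : 0 ≤ (Aᵀ * A).trace := by
  rw [← Matrix.conjTranspose_eq_transpose_of_trivial]
  exact (Matrix.posSemidef_conjTranspose_mul_self A).trace_nonneg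

theorem metric_self_nonneg (A : Matrix (Fin p) (Fin p) ℝ) : 0 ≤ metric A A :=
  mul_nonneg (by norm_num) (trace_transpose_mul_self_nonneg A)

theorem trace_mul_sq_le (A B : Matrix (Fin p) (Fin p) ℝ) :
    (A * B).trace ^ 2 ≤ (A * Aᵀ).trace * (Bᵀ * B).trace := by
  have h := Finset.sum_mul_sq_le_sq_mul_sq (Finset.univ : Finset (Fin p × Fin p))
    (fun x => A x.1 x.2) (fun x => B x.2 x.1)
  simp only [Fintype.sum_prod_type] at h
  have h1 : (A * B).trace = ∑ x, ∑ y, A x y * B y x := by simp [Matrix.trace, Matrix.mul_apply]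
  have h2 : (A * Aᵀ).trace = ∑ x, ∑ y, A x y ^ 2 := by
    simp [Matrix.trace, Matrix.mul_apply, sq]
  have h3 : (Bᵀ * B).trace = ∑ x, ∑ y, B y x ^ 2 := by
    simp [Matrix.trace, Matrix.mul_apply, sq]
  rwa [h1, h2, h3]

theorem trace_aeval (M : Matrix (Fin p) (Fin p) ℝ) (q : Polynomial ℝ) :
    (Polynomial.aeval M q).trace
      = ∑ k ∈ Finset.range (q.natDegree + 1), q.coeff k * (M ^ k).trace := by
  rw [Polynomial.aeval_eq_sum_range, Matrix.trace_sum]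
  simp

theorem transpose_aeval {M : Matrix (Fin p) (Fin p) ℝ} (hM : Mᵀ = M) (q : Polynomial ℝ) :
    (Polynomial.aeval M q)ᵀ = Polynomial.aeval M q := by
  rw [Polynomial.aeval_eq_sum_range, Matrix.transpose_sum]
  simp [Matrix.transpose_pow, hM]

theorem commute_aeval {M W : Matrix (Fin p) (Fin p) ℝ} (h : Commute M W) (q : Polynomial ℝ) :
    Commute (Polynomial.aeval M q) W := by
  rw [Polynomial.aeval_eq_sum_range]
  exact Commute.sum_left _ _ _ fun k _ => (h.pow_left k).smul_left _

theorem trace_aeval_nonneg {M : Matrix (Fin p) (Fin p) ℝ} (hM : M.PosSemidef) {q : Polynomial ℝ}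
    (hq : ∀ k, 0 ≤ q.coeff k) : 0 ≤ (Polynomial.aeval M q).trace := by
  rw [trace_aeval]
  exact Finset.sum_nonneg fun k _ => mul_nonneg (hq k) (hM.pow k).trace_nonneg

/-- The matrix `2 - W - Wᵀ = (1 - W)ᵀ (1 - W)` for orthogonal `W`; its eigenvalues are
`2 - 2 cos θ` for the rotation angles `θ` of `W`. -/
def chord (W : Matrix (Fin p) (Fin p) ℝ) : Matrix (Fin p) (Fin p) ℝ := 2 - W - Wᵀ

theorem chord_transpose (W : Matrix (Fin p) (Fin p) ℝ) : (chord W)ᵀ = chord W := by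
  simp only [chord, Matrix.transpose_sub, Matrix.transpose_transpose, Matrix.transpose_ofNat]
  abel

theorem chord_posSemidef {W : Matrix (Fin p) (Fin p) ℝ} (hW : Wᵀ * W = 1) :
    (chord W).PosSemidef := by
  have : chord W = (1 - W)ᴴ * (1 - W) := by
    rw [Matrix.conjTranspose_eq_transpose_of_trivial, Matrix.transpose_sub, Matrix.transpose_one,
      sub_mul, mul_sub, mul_sub, hW, chord, ← one_add_one_eq_two]
    noncomm_ring
  rw [this]
  exact Matrix.posSemidef_conjTranspose_mul_self _

theorem commute_chord {W : Matrix (Fin p) (Fin p) ℝ} (hW : Wᵀ * W = 1) :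
    Commute (chord W) W := by
  have h' : W * Wᵀ = 1 := mul_eq_one_comm.1 hW
  rw [Commute, SemiconjBy, chord, sub_mul, sub_mul, mul_sub, mul_sub, hW, h', mul_two, two_mul]

/-- The gradient estimate for the trace of a polynomial in `chord W`. -/
theorem trace_derivative_mul_sq_le {W X : Matrix (Fin p) (Fin p) ℝ} (hW : Wᵀ * W = 1)
    (hX : (Wᵀ * X)ᵀ = -(Wᵀ * X)) {q : Polynomial ℝ}
    (hq : ∀ k, 0 ≤ (4 * q - Polynomial.X * (4 - Polynomial.X) * q.derivative ^ 2).coeff k) :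
    (Polynomial.aeval (chord W) q.derivative * X).trace ^ 2
      ≤ (Polynomial.aeval (chord W) q).trace * (Xᵀ * X).trace := by
  have h' : W * Wᵀ = 1 := mul_eq_one_comm.1 hW
  set M := chord W with hM
  set T := Polynomial.aeval M q.derivative with hT
  have hTt : Tᵀ = T := transpose_aeval (chord_transpose W) _
  have hTW : T * W = W * T := commute_aeval (commute_chord hW) _
  obtain ⟨O, hO⟩ : ∃ O, O = Wᵀ * X := ⟨_, rfl⟩
  rw [← hO] at hX
  have hXO : X = W * O := by rw [hO, ← mul_assoc, h', one_mul]
  -- Pairing with the antisymmetric `O` only sees the antisymmetric part `K` of `T W`;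
  -- Cauchy–Schwarz is applied to `K` and `O`.
  set K := (1 / 2 : ℝ) • (T * (W - Wᵀ)) with hK
  have h1 : (T * X).trace = (K * O).trace := by
    have e : (T * Wᵀ * O).trace = -(T * W * O).trace := by
      rw [← Matrix.trace_transpose, Matrix.transpose_mul (T * Wᵀ) O, Matrix.transpose_mul, hTt,
        Matrix.transpose_transpose, hX, neg_mul, Matrix.trace_neg, Matrix.trace_mul_comm, hTW]
    rw [hK, hXO, smul_mul_assoc, Matrix.trace_smul, mul_sub, sub_mul, Matrix.trace_sub, e,
      ← mul_assoc, smul_eq_mul]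
    ring
  have h2 : (Xᵀ * X).trace = (Oᵀ * O).trace := by
    rw [hXO, Matrix.transpose_mul, mul_assoc, ← mul_assoc Wᵀ, hW, one_mul]
  have h3 : (W - Wᵀ) * (Wᵀ - W) = M * (4 - M) := by
    have e4 : (4 : Matrix (Fin p) (Fin p) ℝ) = 1 + 1 + 1 + 1 := by norm_num
    rw [hM, chord, ← one_add_one_eq_two, e4]
    have e : (1 + 1 - W - Wᵀ) * (1 + 1 + 1 + 1 - (1 + 1 - W - Wᵀ))
        = 1 + 1 + 1 + 1 - W * W - Wᵀ * Wᵀ - W * Wᵀ - Wᵀ * W := by noncomm_ring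
    rw [e, h', hW, sub_mul, mul_sub, mul_sub, h', hW]
    noncomm_ring
  -- `K Kᵀ` is a quarter of `M (4 - M) q'(M)^2`, so the eikonal inequality applies. Coefficientwise
  -- positivity suffices since `M` is positive semidefinite.
  have h4 : (K * Kᵀ).trace ≤ (Polynomial.aeval M q).trace := by
    have e : K * Kᵀ = (1 / 4 : ℝ) • Polynomial.aeval M
        (Polynomial.X * (4 - Polynomial.X) * q.derivative ^ 2) := by
      rw [hK, Matrix.transpose_smul, Matrix.transpose_mul, Matrix.transpose_sub,
        Matrix.transpose_transpose, hTt, smul_mul_smul_comm, mul_assoc, ← mul_assoc (W - Wᵀ), h3]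
      simp only [map_mul, map_sub, map_pow, Polynomial.aeval_X, map_ofNat]
      rw [← hT]
      have c1 : Commute T (M * (4 - M)) := by
        have c : Commute M T := (commute_aeval (Commute.refl M) _).symm
        exact (c.mul_left ((Commute.ofNat_left 4 T).sub_left c)).symm
      rw [← mul_assoc, c1.eq, mul_assoc, sq]
      norm_num
    have d := trace_aeval_nonneg (chord_posSemidef hW) hq
    rw [map_sub, Matrix.trace_sub, map_mul, map_ofNat, ← hM] at d
    rw [e, Matrix.trace_smul, smul_eq_mul]
    have : ((4 : Matrix (Fin p) (Fin p) ℝ) * Polynomial.aeval M q).trace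
        = 4 * (Polynomial.aeval M q).trace := by
      rw [show (4 : Matrix (Fin p) (Fin p) ℝ) = (4 : ℝ) • 1 by
        rw [Algebra.smul_def, mul_one, map_ofNat], smul_mul_assoc, one_mul, Matrix.trace_smul,
        smul_eq_mul]
    rw [this] at d
    linarith
  calc (T * X).trace ^ 2 = (K * O).trace ^ 2 := by rw [h1]
    _ ≤ (K * Kᵀ).trace * (Oᵀ * O).trace := trace_mul_sq_le K O
    _ ≤ (Polynomial.aeval M q).trace * (Oᵀ * O).trace :=
      mul_le_mul_of_nonneg_right h4 (trace_transpose_mul_self_nonneg O)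
    _ = _ := by rw [h2]

/-- Although `M` and `M'` need not commute, the product rule for powers simplifies under the trace
by cyclicity. -/
theorem hasDerivAt_trace_aeval {M : ℝ → Matrix (Fin p) (Fin p) ℝ} {M' : Matrix (Fin p) (Fin p) ℝ}
    {t : ℝ} (h : HasDerivAt M M' t) (q : Polynomial ℝ) :
    HasDerivAt (fun s => (Polynomial.aeval (M s) q).trace)
      ((Polynomial.aeval (M t) q.derivative * M').trace) t := by
  have htr : ∀ (F : ℝ → Matrix (Fin p) (Fin p) ℝ) (F' : Matrix (Fin p) (Fin p) ℝ),
      HasDerivAt F F' t → HasDerivAt (fun s => (F s).trace) F'.trace t := fun F F' hF =>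
    (LinearMap.toContinuousLinearMap (Matrix.traceLinearMap (Fin p) ℝ ℝ)).hasFDerivAt.comp_hasDerivAt
      t hF
  induction q using Polynomial.induction_on' with
  | add a b ha hb =>
    simp only [map_add, Matrix.trace_add, add_mul]
    exact ha.add hb
  | monomial n a =>
    simp only [Polynomial.aeval_monomial, Polynomial.derivative_monomial]
    have hp := htr _ _ (h.fun_pow' n)
    have := hp.const_mul a
    simp only [← Algebra.smul_def, Matrix.trace_smul, smul_eq_mul, smul_mul_assoc]
    refine this.congr_deriv ?_
    rw [Matrix.trace_sum, mul_assoc]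
    congr 1
    rw [Finset.sum_congr rfl (g := fun _ => (M t ^ (n - 1) * M').trace), Finset.sum_const,
      Finset.card_range, nsmul_eq_mul]
    intro i hi
    rw [Finset.mem_range] at hi
    rw [Matrix.trace_mul_comm, ← mul_assoc, ← pow_add, Nat.pred_eq_sub_one]
    congr 3
    omega

end TraceInequalities

/-! ### Lower bounds for lengths and distances. -/

section LowerBound

variable {p : ℕ}

theorem SO.transpose_mul_self (U : SO p) : (U.1)ᵀ * U.1 = 1 :=
  (Matrix.mem_orthogonalGroup_iff' (Fin p) ℝ).1 (Matrix.mem_specialOrthogonalGroup_iff.1 U.2).1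

theorem SO.mul_transpose_self (U : SO p) : U.1 * (U.1)ᵀ = 1 :=
  mul_eq_one_comm.1 U.transpose_mul_self

theorem length_nonneg (γ : ℝ → SO p) : 0 ≤ length γ :=
  intervalIntegral.integral_nonneg zero_le_one fun _ _ => Real.sqrt_nonneg _

/-- The squared distance from the identity, truncated. -/
noncomputable def sqDistTrunc (N : ℕ) (W : Matrix (Fin p) (Fin p) ℝ) : ℝ :=
  (1 / 2) * (Polynomial.aeval (chord W) (arccosSq N)).trace

theorem sqDistTrunc_nonneg (N : ℕ) {W : Matrix (Fin p) (Fin p) ℝ} (hW : Wᵀ * W = 1) :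
    0 ≤ sqDistTrunc N W :=
  mul_nonneg (by norm_num) (trace_aeval_nonneg (chord_posSemidef hW) (arccosSq_coeff_nonneg N))

theorem sqDistTrunc_one (N : ℕ) : sqDistTrunc N (1 : Matrix (Fin p) (Fin p) ℝ) = 0 := by
  have h : chord (1 : Matrix (Fin p) (Fin p) ℝ) = 0 := by
    rw [chord, Matrix.transpose_one, ← one_add_one_eq_two]; abel
  rw [sqDistTrunc, h]
  simp [Polynomial.aeval_def, Polynomial.eval₂_at_zero, arccosSq_coeff_zero]

theorem sqrt_sqDistTrunc_le_length (N : ℕ) {γ : ℝ → SO p}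
    (hγ : ContDiffOn ℝ 1 (toCurve γ) (Set.Icc 0 1)) :
    √(sqDistTrunc N (((γ 0).1)ᵀ * (γ 1).1)) ≤ length γ := by
  set U := (γ 0).1 with hU
  set W : ℝ → Matrix (Fin p) (Fin p) ℝ := fun t => Uᵀ * toCurve γ t with hWdef
  have horth : ∀ t, (toCurve γ t)ᵀ * toCurve γ t = 1 := fun t => (γ t).transpose_mul_self
  have hWW : ∀ t, (W t)ᵀ * W t = 1 := fun t => by
    rw [hWdef]
    simp only
    rw [Matrix.transpose_mul, Matrix.transpose_transpose, mul_assoc, ← mul_assoc U,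
      (γ 0).mul_transpose_self, one_mul, horth]
  set φ : ℝ → ℝ := fun t => sqDistTrunc N (W t) with hφ
  have hφ0 : φ 0 = 0 := by
    rw [hφ]; simp only; rw [hWdef]; simp only
    rw [show toCurve γ 0 = U from rfl, (γ 0).transpose_mul_self, sqDistTrunc_one]
  have hφn : ∀ t, 0 ≤ φ t := fun t => sqDistTrunc_nonneg N (hWW t)
  set v : ℝ → ℝ := fun t => √(metric (derivWithin (toCurve γ) (Set.Icc 0 1) t)
    (derivWithin (toCurve γ) (Set.Icc 0 1) t)) with hv
  have hvc : ContinuousOn v (Set.Icc 0 1) := by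
    have hd := hγ.continuousOn_derivWithin (uniqueDiffOn_Icc_zero_one) le_rfl
    refine ContinuousOn.sqrt (continuousOn_const.mul ?_)
    exact (Continuous.matrix_trace (A := fun X : Matrix (Fin p) (Fin p) ℝ => Xᵀ * X)
      (by fun_prop)).comp_continuousOn hd
  have hφc : ContinuousOn φ (Set.Icc 0 1) := by
    refine continuousOn_const.mul ?_
    refine (Continuous.matrix_trace (A := fun X : Matrix (Fin p) (Fin p) ℝ =>
      Polynomial.aeval (chord (Uᵀ * X)) (arccosSq N)) ?_).comp_continuousOn hγ.continuousOn
    refine (Polynomial.continuous_aeval _).comp ?_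
    unfold chord
    fun_prop
  have hderiv : ∀ t ∈ Set.Ioo (0 : ℝ) 1, ∃ φ', HasDerivAt φ φ' t ∧ |φ'| ≤ 2 * (√(φ t) * v t) := by
    intro t ht
    have hnhds : Set.Icc (0 : ℝ) 1 ∈ nhds t := Icc_mem_nhds ht.1 ht.2
    set X := derivWithin (toCurve γ) (Set.Icc 0 1) t with hX
    have hγt : HasDerivAt (toCurve γ) X t :=
      ((hγ.differentiableOn one_ne_zero t (Set.Ioo_subset_Icc_self ht)).hasDerivWithinAt).hasDerivAt
        hnhds
    have htr : ∀ (F : ℝ → Matrix (Fin p) (Fin p) ℝ) (F' : Matrix (Fin p) (Fin p) ℝ),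
        HasDerivAt F F' t → HasDerivAt (fun s => (F s)ᵀ) F'ᵀ t := fun F F' hF =>
      (LinearMap.toContinuousLinearMap
        (Matrix.transposeLinearEquiv (Fin p) (Fin p) ℝ ℝ).toLinearMap).hasFDerivAt.comp_hasDerivAt
        t hF
    have hWt : HasDerivAt W (Uᵀ * X) t := hγt.const_mul Uᵀ
    have hM : HasDerivAt (fun s => chord (W s)) (-(Uᵀ * X) - (Uᵀ * X)ᵀ) t := by
      have := (hWt.const_sub 2).sub (htr _ _ hWt)
      exact this
    have hφt := (hasDerivAt_trace_aeval hM (arccosSq N)).const_mul (1 / 2 : ℝ)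
    refine ⟨_, hφt, ?_⟩
    set T := Polynomial.aeval (chord (W t)) (Polynomial.derivative (arccosSq N)) with hT
    have hTt : Tᵀ = T := transpose_aeval (chord_transpose _) _
    have e1 : (T * (-(Uᵀ * X) - (Uᵀ * X)ᵀ)).trace = -2 * (T * (Uᵀ * X)).trace := by
      have : (T * (Uᵀ * X)ᵀ).trace = (T * (Uᵀ * X)).trace := by
        rw [← Matrix.trace_transpose, Matrix.transpose_mul T, Matrix.transpose_transpose, hTt,
          Matrix.trace_mul_comm]
      rw [mul_sub, mul_neg, Matrix.trace_sub, Matrix.trace_neg, this]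
      ring
    have hWX : (W t)ᵀ * (Uᵀ * X) = (toCurve γ t)ᵀ * X := by
      rw [hWdef]
      simp only
      rw [Matrix.transpose_mul, Matrix.transpose_transpose, mul_assoc, ← mul_assoc U,
        (γ 0).mul_transpose_self, one_mul]
    have hskew : ((toCurve γ t)ᵀ * X)ᵀ = -((toCurve γ t)ᵀ * X) := by
      have h1 := (htr _ _ hγt).mul hγt
      have h2 : HasDerivAt ((fun s => (toCurve γ s)ᵀ) * toCurve γ) 0 t := by
        have : ((fun s => (toCurve γ s)ᵀ) * toCurve γ) = fun _ => 1 := funext horth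
        rw [this]
        exact hasDerivAt_const _ _
      have := h1.unique h2
      rw [Matrix.transpose_mul, Matrix.transpose_transpose]
      exact eq_neg_of_add_eq_zero_left this
    have hmain := trace_derivative_mul_sq_le (hWW t) (X := Uᵀ * X) (by rw [hWX, hskew])
      (arccosSq_defect_coeff_nonneg N)
    rw [← hT] at hmain
    have hXX : (Uᵀ * X)ᵀ * (Uᵀ * X) = Xᵀ * X := by
      rw [Matrix.transpose_mul, Matrix.transpose_transpose, mul_assoc, ← mul_assoc U,
        (γ 0).mul_transpose_self, one_mul]
    rw [hXX] at hmain
    rw [e1]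
    have hvt : v t = √(metric X X) := rfl
    rw [hvt, ← Real.sqrt_mul (hφn t)]
    have hsq : ((T * (Uᵀ * X)).trace / 2) ^ 2 ≤ φ t * metric X X := by
      have : φ t * metric X X = (1 / 4) *
          ((Polynomial.aeval (chord (W t)) (arccosSq N)).trace * (Xᵀ * X).trace) := by
        rw [hφ, metric]; simp only [sqDistTrunc]; ring
      rw [this]
      linarith
    have := Real.abs_le_sqrt hsq
    rw [abs_div, abs_two] at this
    rw [← mul_assoc, abs_mul]
    norm_num
    linarith
  have hlen : length γ = ∫ t in (0 : ℝ)..1, v t := rfl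
  -- The square root is not differentiable at `φ = 0`, which occurs at `t = 0`; `φ + ε` is used
  -- instead.
  have key : ∀ ε : ℝ, 0 < ε → √(φ 1) ≤ √ε + length γ := by
    intro ε hε
    choose! φ' hφ' hφ'le using hderiv
    have := intervalIntegral.sub_le_integral_of_hasDeriv_right_of_le
      (g := fun t => √(φ t + ε)) (g' := fun t => φ' t / (2 * √(φ t + ε))) (φ := v)
      zero_le_one ((hφc.add continuousOn_const).sqrt)
      (fun t ht => (((hφ' t ht).add_const ε).sqrt
        (by have := hφn t; positivity)).hasDerivWithinAt)
      (hvc.integrableOn_Icc) (fun t ht => by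
        have h0 := hφn t
        have hpos : 0 < √(φ t + ε) := Real.sqrt_pos.2 (by linarith)
        have hle : √(φ t) ≤ √(φ t + ε) := Real.sqrt_le_sqrt (by linarith)
        have hv0 : 0 ≤ v t := Real.sqrt_nonneg _
        rw [div_le_iff₀ (by positivity)]
        calc φ' t ≤ |φ' t| := le_abs_self _
          _ ≤ 2 * (√(φ t) * v t) := hφ'le t ht
          _ ≤ 2 * (√(φ t + ε) * v t) := by gcongr
          _ = _ := by ring)
    simp only [hφ0, zero_add] at this
    rw [← hlen] at this
    have h1 : √(φ 1) ≤ √(φ 1 + ε) := Real.sqrt_le_sqrt (by linarith)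
    linarith
  change √(φ 1) ≤ length γ
  refine le_of_forall_pos_le_add fun δ hδ => ?_
  have := key (δ ^ 2) (by positivity)
  rw [Real.sqrt_sq hδ.le] at this
  linarith

/-- A connecting curve `δ` is required because the infimum of the empty set is `0`. -/
theorem sqrt_sqDistTrunc_le_dist (N : ℕ) {U V : SO p} {δ : ℝ → SO p}
    (hδ : ContDiffOn ℝ 1 (toCurve δ) (Set.Icc 0 1)) (h0 : δ 0 = U) (h1 : δ 1 = V) :
    √(sqDistTrunc N ((U.1)ᵀ * V.1)) ≤ dist U V := by
  refine le_csInf ⟨_, δ, hδ, h0, h1, rfl⟩ ?_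
  rintro L ⟨γ, hγ, rfl, rfl, rfl⟩
  exact sqrt_sqDistTrunc_le_length N hγ

theorem dist_le_length {U V : SO p} {γ : ℝ → SO p}
    (hγ : ContDiffOn ℝ 1 (toCurve γ) (Set.Icc 0 1)) (h0 : γ 0 = U) (h1 : γ 1 = V) :
    dist U V ≤ length γ := by
  refine csInf_le ⟨0, ?_⟩ ⟨γ, hγ, h0, h1, rfl⟩
  rintro L ⟨γ, -, -, -, rfl⟩
  exact length_nonneg γ

theorem dist_nonneg (U V : SO p) : 0 ≤ dist U V := by
  refine Real.sInf_nonneg ?_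
  rintro L ⟨γ, -, -, -, rfl⟩
  exact length_nonneg γ

end LowerBound

/-! ### One-parameter subgroups and geodesics. -/

section Exponential

variable {p : ℕ}

theorem exp_transpose_mul_exp {A : Matrix (Fin p) (Fin p) ℝ} (hA : Aᵀ = -A) :
    (NormedSpace.exp A)ᵀ * NormedSpace.exp A = 1 := by
  rw [← Matrix.exp_transpose, hA, ← Matrix.exp_add_of_commute _ _ (Commute.refl A).neg_left,
    neg_add_cancel, NormedSpace.exp_zero]

theorem exp_mem_specialOrthogonal {A : Matrix (Fin p) (Fin p) ℝ} (hA : Aᵀ = -A) :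
    NormedSpace.exp A ∈ Matrix.specialOrthogonalGroup (Fin p) ℝ := by
  have ho := exp_transpose_mul_exp hA
  refine Matrix.mem_specialOrthogonalGroup_iff.2
    ⟨(Matrix.mem_orthogonalGroup_iff' (Fin p) ℝ).2 ho, ?_⟩
  have h1 : (NormedSpace.exp A).det ^ 2 = 1 := by
    have := congrArg Matrix.det ho
    rwa [Matrix.det_mul, Matrix.det_transpose, Matrix.det_one, ← sq] at this
  -- Being a square, the exponential has nonnegative determinant, which excludes `-1`.
  have h2 : NormedSpace.exp A
      = NormedSpace.exp ((1 / 2 : ℝ) • A) * NormedSpace.exp ((1 / 2 : ℝ) • A) := by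
    rw [← Matrix.exp_add_of_commute _ _ rfl, ← add_smul]
    norm_num
  have h3 : 0 ≤ (NormedSpace.exp A).det := by
    rw [h2, Matrix.det_mul]
    exact mul_self_nonneg _
  nlinarith

/-- The exponential of an antisymmetric matrix. -/
noncomputable def expSO (A : Matrix (Fin p) (Fin p) ℝ) (hA : Aᵀ = -A) : SO p :=
  ⟨NormedSpace.exp A, exp_mem_specialOrthogonal hA⟩

theorem smul_skew {A : Matrix (Fin p) (Fin p) ℝ} (hA : Aᵀ = -A) (t : ℝ) :
    (t • A)ᵀ = -(t • A) := by
  rw [Matrix.transpose_smul, hA, smul_neg]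

/-- The curve `t ↦ U exp (t A)`. -/
noncomputable def expCurve (U : SO p) (A : Matrix (Fin p) (Fin p) ℝ) (hA : Aᵀ = -A) (t : ℝ) :
    SO p :=
  U * expSO (t • A) (smul_skew hA t)

theorem toCurve_expCurve (U : SO p) (A : Matrix (Fin p) (Fin p) ℝ) (hA : Aᵀ = -A) :
    toCurve (expCurve U A hA) = fun t => U.1 * NormedSpace.exp (t • A) := rfl

theorem hasDerivAt_expCurve (U : SO p) (A : Matrix (Fin p) (Fin p) ℝ) (hA : Aᵀ = -A) (t : ℝ) :
    HasDerivAt (toCurve (expCurve U A hA)) (toCurve (expCurve U A hA) t * A) t := by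
  rw [toCurve_expCurve]
  simp only [mul_assoc]
  exact (hasDerivAt_exp_smul_const A t).const_mul U.1

theorem contDiff_expCurve (U : SO p) (A : Matrix (Fin p) (Fin p) ℝ) (hA : Aᵀ = -A) {n : ℕ∞} :
    ContDiff ℝ n (toCurve (expCurve U A hA)) := by
  rw [toCurve_expCurve]
  refine contDiff_const.mul ?_
  have : ContDiff ℝ n (NormedSpace.exp : Matrix (Fin p) (Fin p) ℝ → _) :=
    contDiff_iff_contDiffAt.2 fun x => (NormedSpace.exp_analytic (𝕂 := ℝ) x).contDiffAt
  exact this.comp (contDiff_id.smul contDiff_const)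

theorem metric_orthogonal_mul {W : Matrix (Fin p) (Fin p) ℝ} (hW : Wᵀ * W = 1)
    (A B : Matrix (Fin p) (Fin p) ℝ) : metric (W * A) (W * B) = metric A B := by
  rw [metric, Matrix.transpose_mul, mul_assoc, ← mul_assoc Wᵀ, hW, one_mul, metric]

theorem length_expCurve (U : SO p) (A : Matrix (Fin p) (Fin p) ℝ) (hA : Aᵀ = -A) :
    length (expCurve U A hA) = √(metric A A) := by
  rw [length, intervalIntegral.integral_congr (g := fun _ => √(metric A A))]
  · simp
  · intro t ht
    rw [Set.uIcc_of_le zero_le_one] at ht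
    simp only
    have hd : derivWithin (toCurve (expCurve U A hA)) (Set.Icc 0 1) t
        = toCurve (expCurve U A hA) t * A :=
      (hasDerivAt_expCurve U A hA t).hasDerivWithinAt.derivWithin (uniqueDiffOn_Icc_zero_one t ht)
    rw [hd, toCurve,
      metric_orthogonal_mul (expCurve U A hA t).transpose_mul_self]

theorem expCurve_zero (U : SO p) (A : Matrix (Fin p) (Fin p) ℝ) (hA : Aᵀ = -A) :
    expCurve U A hA 0 = U := by
  apply Subtype.ext
  change U.1 * NormedSpace.exp ((0 : ℝ) • A) = U.1
  rw [zero_smul, NormedSpace.exp_zero, mul_one]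

theorem expCurve_one {U V : SO p} {A : Matrix (Fin p) (Fin p) ℝ} (hA : Aᵀ = -A)
    (h : (U.1)ᵀ * V.1 = NormedSpace.exp A) : expCurve U A hA 1 = V := by
  apply Subtype.ext
  change U.1 * NormedSpace.exp ((1 : ℝ) • A) = V.1
  rw [one_smul, ← h, ← mul_assoc, U.mul_transpose_self, one_mul]

theorem dist_le_of_exp {U V : SO p} {A : Matrix (Fin p) (Fin p) ℝ} (hA : Aᵀ = -A)
    (h : (U.1)ᵀ * V.1 = NormedSpace.exp A) : dist U V ≤ √(metric A A) := by
  rw [← length_expCurve U A hA]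
  exact dist_le_length (contDiff_expCurve U A hA (n := 1)).contDiffOn (expCurve_zero U A hA)
    (expCurve_one hA h)

theorem le_dist_of_exp {U V : SO p} {A : Matrix (Fin p) (Fin p) ℝ} (hA : Aᵀ = -A)
    (h : (U.1)ᵀ * V.1 = NormedSpace.exp A) (N : ℕ) :
    √(sqDistTrunc N (NormedSpace.exp A)) ≤ dist U V := by
  rw [← h]
  exact sqrt_sqDistTrunc_le_dist N (contDiff_expCurve U A hA (n := 1)).contDiffOn
    (expCurve_zero U A hA) (expCurve_one hA h)

theorem transpose_mul_expCurve (U : SO p) (A : Matrix (Fin p) (Fin p) ℝ) (hA : Aᵀ = -A) (t : ℝ) :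
    (U.1)ᵀ * (expCurve U A hA t).1 = NormedSpace.exp (t • A) := by
  change (U.1)ᵀ * (U.1 * NormedSpace.exp (t • A)) = _
  rw [← mul_assoc, U.transpose_mul_self, one_mul]

/-- Uniqueness for the linear differential equation `c' = c A`. -/
theorem eq_mul_exp_of_hasDerivAt {c : ℝ → Matrix (Fin p) (Fin p) ℝ}
    {A : Matrix (Fin p) (Fin p) ℝ} (h : ∀ t, HasDerivAt c (c t * A) t) (t : ℝ) :
    c t = c 0 * NormedSpace.exp (t • A) := by
  have hd : ∀ s, HasDerivAt (fun s => c s * NormedSpace.exp (s • (-A))) 0 s := fun s => by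
    refine ((h s).mul (hasDerivAt_exp_smul_const' (-A) s)).congr_deriv ?_
    rw [mul_assoc, neg_mul, mul_neg, add_neg_cancel]
  have hconst : c t * NormedSpace.exp (t • (-A)) = c 0 * NormedSpace.exp ((0 : ℝ) • (-A)) :=
    is_const_of_deriv_eq_zero (fun s => (hd s).differentiableAt) (fun s => (hd s).deriv) t 0
  rw [zero_smul, NormedSpace.exp_zero, mul_one] at hconst
  rw [← hconst, mul_assoc, ← Matrix.exp_add_of_commute]
  · rw [smul_neg, neg_add_cancel, NormedSpace.exp_zero, mul_one]
  · exact ((Commute.refl A).neg_left.smul_left t).smul_right t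

/-- Rodrigues' formula. -/
theorem exp_smul_of_cube {J : Matrix (Fin p) (Fin p) ℝ} (hJ : J * J * J = -J) (t : ℝ) :
    NormedSpace.exp (t • J) = 1 + Real.sin t • J + (1 - Real.cos t) • (J * J) := by
  have h := eq_mul_exp_of_hasDerivAt
    (c := fun t => 1 + Real.sin t • J + (1 - Real.cos t) • (J * J)) (A := J) (fun t => by
      have h1 := ((Real.hasDerivAt_sin t).smul_const J)
      have h2 := (((Real.hasDerivAt_cos t).const_sub 1).smul_const (J * J))
      refine ((h1.const_add 1).add h2).congr_deriv ?_
      rw [add_mul, add_mul, one_mul, smul_mul_assoc, smul_mul_assoc, hJ]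
      module) t
  simp only [Real.sin_zero, Real.cos_zero, zero_smul, sub_self, add_zero, one_mul] at h
  exact h.symm

/-- Every unit-speed geodesic is a left translate of a one-parameter subgroup. -/
theorem IsUnitGeodesic.eq_expCurve {γ : ℝ → SO p} (h : IsUnitGeodesic γ) :
    ∃ (A : Matrix (Fin p) (Fin p) ℝ) (hA : Aᵀ = -A), metric A A = 1 ∧ γ = expCurve (γ 0) A hA := by
  set c := toCurve γ with hc
  have horth : ∀ t, (c t)ᵀ * c t = 1 := fun t => (γ t).transpose_mul_self
  have horth' : ∀ t, c t * (c t)ᵀ = 1 := fun t => (γ t).mul_transpose_self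
  have hd1 : ∀ t, HasDerivAt c (deriv c t) t := fun t =>
    (h.smooth.differentiable (by simp) t).hasDerivAt
  have hd2 : ∀ t, HasDerivAt (deriv c) (deriv (deriv c) t) t := fun t => by
    have : ContDiff ℝ (⊤ : ℕ∞) (deriv c) := (contDiff_infty_iff_deriv.1 h.smooth).2
    exact (this.differentiable (by simp) t).hasDerivAt
  have htr : ∀ t (F : ℝ → Matrix (Fin p) (Fin p) ℝ) (F' : Matrix (Fin p) (Fin p) ℝ),
      HasDerivAt F F' t → HasDerivAt (fun s => (F s)ᵀ) F'ᵀ t := fun t F F' hF =>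
    (LinearMap.toContinuousLinearMap
      (Matrix.transposeLinearEquiv (Fin p) (Fin p) ℝ ℝ).toLinearMap).hasFDerivAt.comp_hasDerivAt
      t hF
  set Ω : ℝ → Matrix (Fin p) (Fin p) ℝ := fun t => (c t)ᵀ * deriv c t with hΩ
  have hskew : ∀ t, (Ω t)ᵀ = -Ω t := fun t => by
    have h1 := (htr t _ _ (hd1 t)).mul (hd1 t)
    have h2 : HasDerivAt ((fun s => (c s)ᵀ) * c) 0 t := by
      have : ((fun s => (c s)ᵀ) * c) = fun _ => 1 := funext horth
      rw [this]
      exact hasDerivAt_const _ _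
    have := h1.unique h2
    simp only [hΩ]
    rw [Matrix.transpose_mul, Matrix.transpose_transpose]
    exact eq_neg_of_add_eq_zero_left this
  have hΩd : ∀ t, HasDerivAt Ω ((deriv c t)ᵀ * deriv c t + (c t)ᵀ * deriv (deriv c) t) t :=
    fun t => (htr t _ _ (hd1 t)).mul (hd2 t)
  have hΩ0 : ∀ t, HasDerivAt Ω 0 t := fun t => by
    set D := (deriv c t)ᵀ * deriv c t + (c t)ᵀ * deriv (deriv c) t with hD
    have hDs : Dᵀ = -D := by
      have h1 := htr t _ _ (hΩd t)
      have h2 : (fun s => (Ω s)ᵀ) = fun s => -Ω s := funext hskew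
      rw [h2] at h1
      exact h1.unique (hΩd t).neg
    -- The derivative `D` of `Ω` is antisymmetric, so the vanishing acceleration may be tested
    -- against `D` itself. The remaining term of `D`, the symmetric `(γ')ᵀ γ'`, is trace-orthogonal
    -- to `D`, whence `D = 0`.
    have hacc := h.acceleration t (c t * D * (c t)ᵀ) (by
      rw [Matrix.transpose_mul, Matrix.transpose_mul, Matrix.transpose_transpose, hDs]
      noncomm_ring)
    rw [← hc, mul_assoc, horth, mul_one, metric, ← mul_assoc] at hacc
    have hzero : (Dᵀ * D).trace = 0 := by
      have e1 : Dᵀ = (deriv c t)ᵀ * deriv c t + (deriv (deriv c) t)ᵀ * c t := by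
        rw [hD, Matrix.transpose_add, Matrix.transpose_mul, Matrix.transpose_mul,
          Matrix.transpose_transpose, Matrix.transpose_transpose]
      have e2 : ((deriv c t)ᵀ * deriv c t * D).trace = 0 := by
        have : ((deriv c t)ᵀ * deriv c t * D).trace = -((deriv c t)ᵀ * deriv c t * D).trace := by
          conv_lhs => rw [← Matrix.trace_transpose, Matrix.transpose_mul, Matrix.transpose_mul,
            Matrix.transpose_transpose, hDs, neg_mul, Matrix.trace_neg, Matrix.trace_mul_comm]
        linarith
      conv_lhs => rw [e1]
      rw [add_mul, Matrix.trace_add, e2]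
      linarith
    have : D = 0 := by
      rw [← Matrix.conjTranspose_eq_transpose_of_trivial] at hzero
      exact Matrix.trace_conjTranspose_mul_self_eq_zero_iff.1 hzero
    rw [← this]
    exact hΩd t
  have hconst : ∀ t, Ω t = Ω 0 := fun t =>
    is_const_of_deriv_eq_zero (fun s => (hΩ0 s).differentiableAt) (fun s => (hΩ0 s).deriv) t 0
  have hder : ∀ t, deriv c t = c t * Ω 0 := fun t => by
    rw [← hconst t]
    simp only [hΩ]
    rw [← mul_assoc, horth', one_mul]
  refine ⟨Ω 0, hskew 0, ?_, ?_⟩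
  · have := h.unit_speed 0
    rw [← hc, hder, metric_orthogonal_mul (horth 0)] at this
    exact this
  · funext t
    apply Subtype.ext
    exact eq_mul_exp_of_hasDerivAt (fun t => by rw [← hder]; exact hd1 t) t

theorem isUnitGeodesic_expCurve (U : SO p) {A : Matrix (Fin p) (Fin p) ℝ} (hA : Aᵀ = -A)
    (h1 : metric A A = 1) : IsUnitGeodesic (expCurve U A hA) := by
  have hd : deriv (toCurve (expCurve U A hA)) = fun t => toCurve (expCurve U A hA) t * A :=
    funext fun t => (hasDerivAt_expCurve U A hA t).deriv
  have hdd : ∀ t, deriv (deriv (toCurve (expCurve U A hA))) t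
      = toCurve (expCurve U A hA) t * (A * A) := fun t => by
    rw [hd, ← mul_assoc]
    exact ((hasDerivAt_expCurve U A hA t).mul_const A).deriv
  refine ⟨contDiff_expCurve U A hA, fun t => ?_, fun t B hB => ?_⟩
  · rw [hd]
    simp only [toCurve]
    rw [metric_orthogonal_mul (expCurve U A hA t).transpose_mul_self, h1]
  · rw [hdd]
    set W := toCurve (expCurve U A hA) t with hW
    have hWW : W * Wᵀ = 1 := (expCurve U A hA t).mul_transpose_self
    have e : ((W * (A * A))ᵀ * (B * W)).trace = -((W * (A * A))ᵀ * (B * W)).trace := by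
      conv_lhs => rw [← Matrix.trace_transpose]
      rw [Matrix.transpose_mul, Matrix.transpose_transpose, Matrix.transpose_mul, hB,
        Matrix.transpose_mul W, Matrix.transpose_mul, hA]
      rw [mul_neg, neg_mul, Matrix.trace_neg, neg_mul_neg, neg_inj, mul_assoc,
        Matrix.trace_mul_comm, mul_assoc, mul_assoc, mul_assoc, ← mul_assoc B,
        Matrix.trace_mul_comm, mul_assoc]
    rw [metric]
    linarith

theorem mem_cutLocus_expCurve {U : SO p} {A : Matrix (Fin p) (Fin p) ℝ} (hA : Aᵀ = -A)
    (h1 : metric A A = 1) {t₀ : ℝ} (h : IsLUB {t : ℝ | 0 < t ∧ dist U (expCurve U A hA t) = t} t₀) :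
    expCurve U A hA t₀ ∈ cutLocus U :=
  ⟨_, t₀, isUnitGeodesic_expCurve U hA h1, expCurve_zero U A hA, h, rfl⟩

theorem exists_of_mem_cutLocus {U V : SO p} (h : V ∈ cutLocus U) :
    ∃ (A : Matrix (Fin p) (Fin p) ℝ) (hA : Aᵀ = -A) (t₀ : ℝ), metric A A = 1 ∧
      IsLUB {t : ℝ | 0 < t ∧ dist U (expCurve U A hA t) = t} t₀ ∧
      (U.1)ᵀ * V.1 = NormedSpace.exp (t₀ • A) := by
  obtain ⟨γ, t₀, hγ, rfl, hlub, rfl⟩ := h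
  obtain ⟨A, hA, hm, he⟩ := hγ.eq_expCurve
  refine ⟨A, hA, t₀, hm, ?_, ?_⟩
  · rw [← he]; exact hlub
  · conv_lhs => rw [he]
    rw [expCurve_zero, transpose_mul_expCurve]

/-- The set of minimizing times is exactly `(0, c]`. One direction identifies cut times, the other
produces a cut point. -/
theorem eq_of_isLUB_minimizing {f : ℝ → ℝ} {c t₀ : ℝ} (hc : 0 < c)
    (hle : ∀ t, 0 < t → t ≤ c → f t = t) (hlt : ∀ t, c < t → f t < t) :
    IsLUB {t : ℝ | 0 < t ∧ f t = t} t₀ ↔ t₀ = c := by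
  have : IsLUB {t : ℝ | 0 < t ∧ f t = t} c :=
    ⟨fun t ht => not_lt.1 fun hct => (hlt t hct).ne ht.2, fun b hb => hb ⟨hc, hle c hc le_rfl⟩⟩
  exact ⟨fun h => h.unique this, fun h => h ▸ this⟩

end Exponential

/-! ### Rotations in a single plane. -/

section RankTwo

variable {p : ℕ}

/-- Only positive powers matter since `arccosSq` has no constant term; the kernel of `M` therefore
contributes nothing. -/
theorem trace_aeval_arccosSq {M : Matrix (Fin p) (Fin p) ℝ} {a b u v : ℝ}
    (h : ∀ k : ℕ, (M ^ (k + 1)).trace = a * u ^ (k + 1) + b * v ^ (k + 1)) (N : ℕ) :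
    (Polynomial.aeval M (arccosSq N)).trace
      = a * (arccosSq N).eval u + b * (arccosSq N).eval v := by
  rw [trace_aeval, Polynomial.eval_eq_sum_range, Polynomial.eval_eq_sum_range, Finset.mul_sum,
    Finset.mul_sum, ← Finset.sum_add_distrib]
  refine Finset.sum_congr rfl fun k _ => ?_
  rcases k with _ | k
  · simp [arccosSq_coeff_zero]
  · rw [h]; ring

theorem metric_skew {A : Matrix (Fin p) (Fin p) ℝ} (hA : Aᵀ = -A) :
    metric A A = -(1 / 2) * (A * A).trace := by
  rw [metric, hA, neg_mul, Matrix.trace_neg]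
  ring

theorem metric_smul_smul (t : ℝ) (A : Matrix (Fin p) (Fin p) ℝ) :
    metric (t • A) (t • A) = t ^ 2 * metric A A := by
  simp only [metric, Matrix.transpose_smul, smul_mul_smul_comm, Matrix.trace_smul, smul_eq_mul]
  ring

theorem sqDistTrunc_exp_of_cube {J : Matrix (Fin p) (Fin p) ℝ} (hA : Jᵀ = -J)
    (hJ : J * J * J = -J) (h1 : metric J J = 1) (N : ℕ) (t : ℝ) :
    sqDistTrunc N (NormedSpace.exp (t • J)) = (arccosSq N).eval (2 - 2 * Real.cos t) := by
  have htr : (J * J).trace = -2 := by rw [metric_skew hA] at h1; linarith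
  have hc : chord (NormedSpace.exp (t • J)) = (2 - 2 * Real.cos t) • (-(J * J)) := by
    rw [chord, exp_smul_of_cube hJ, ← one_add_one_eq_two]
    simp only [Matrix.transpose_add, Matrix.transpose_one, Matrix.transpose_smul,
      Matrix.transpose_mul, hA, neg_mul_neg]
    module
  have hp : ∀ k : ℕ, (-(J * J)) ^ (k + 1) = -(J * J) := fun k => by
    induction k with
    | zero => simp
    | succ k ih => rw [pow_succ, ih, neg_mul_neg, ← mul_assoc, hJ, neg_mul]
  rw [sqDistTrunc, hc, trace_aeval_arccosSq (a := 2) (b := 0) (u := 2 - 2 * Real.cos t) (v := 0)]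
  · ring
  · intro k
    rw [smul_pow, hp, Matrix.trace_smul, Matrix.trace_neg, htr, smul_eq_mul]
    ring

theorem le_dist_of_sqDistTrunc {U V : SO p} {A : Matrix (Fin p) (Fin p) ℝ} (hA : Aᵀ = -A)
    (h : (U.1)ᵀ * V.1 = NormedSpace.exp A) (N : ℕ) :
    sqDistTrunc N (NormedSpace.exp A) ≤ dist U V ^ 2 :=
  Real.sqrt_le_left (dist_nonneg U V) |>.1 (le_dist_of_exp hA h N)

theorem dist_expCurve_of_le_pi (U : SO p) {J : Matrix (Fin p) (Fin p) ℝ} (hA : Jᵀ = -J)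
    (hJ : J * J * J = -J) (h1 : metric J J = 1) {t : ℝ} (h0 : 0 < t) (ht : t ≤ Real.pi) :
    dist U (expCurve U J hA t) = t := by
  apply le_antisymm
  · have := dist_le_of_exp (smul_skew hA t) (transpose_mul_expCurve U J hA t)
    rwa [metric_smul_smul, h1, mul_one, Real.sqrt_sq h0.le] at this
  · refine (sq_le_sq₀ h0.le (dist_nonneg _ _)).1 ?_
    refine sq_le_of_arccosSq_le h0.le ht fun N => ?_
    rw [← sqDistTrunc_exp_of_cube hA hJ h1 N t]
    exact le_dist_of_sqDistTrunc (smul_skew hA t) (transpose_mul_expCurve U J hA t) N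

/-- The exponential is `2π`-periodic along `J`, so the angle `t - 2π`, smaller in absolute value,
reaches the same point. -/
theorem dist_expCurve_of_pi_lt (U : SO p) {J : Matrix (Fin p) (Fin p) ℝ} (hA : Jᵀ = -J)
    (hJ : J * J * J = -J) (h1 : metric J J = 1) {t : ℝ} (ht : Real.pi < t) :
    dist U (expCurve U J hA t) < t := by
  have he : NormedSpace.exp (t • J) = NormedSpace.exp ((t - 2 * Real.pi) • J) := by
    rw [exp_smul_of_cube hJ, exp_smul_of_cube hJ, Real.sin_sub_two_pi, Real.cos_sub_two_pi]
  have := dist_le_of_exp (smul_skew hA (t - 2 * Real.pi))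
    ((transpose_mul_expCurve U J hA t).trans he)
  rw [metric_smul_smul, h1, mul_one, Real.sqrt_sq_eq_abs] at this
  refine this.trans_lt (abs_lt.2 ⟨?_, ?_⟩) <;> linarith [Real.pi_pos]

theorem isLUB_minimizing_of_cube (U : SO p) {J : Matrix (Fin p) (Fin p) ℝ} (hA : Jᵀ = -J)
    (hJ : J * J * J = -J) (h1 : metric J J = 1) {t₀ : ℝ} :
    IsLUB {t : ℝ | 0 < t ∧ dist U (expCurve U J hA t) = t} t₀ ↔ t₀ = Real.pi :=
  eq_of_isLUB_minimizing Real.pi_pos (fun _ => dist_expCurve_of_le_pi U hA hJ h1)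
    fun _ => dist_expCurve_of_pi_lt U hA hJ h1

theorem exp_pi_smul_of_cube {J : Matrix (Fin p) (Fin p) ℝ} (hJ : J * J * J = -J) :
    NormedSpace.exp (Real.pi • J) = 1 + (2 : ℝ) • (J * J) := by
  rw [exp_smul_of_cube hJ, Real.sin_pi, Real.cos_pi]
  norm_num

/-- The infinitesimal rotation in the plane spanned by two orthonormal vectors. -/
def planeGen (u v : Fin p → ℝ) : Matrix (Fin p) (Fin p) ℝ :=
  Matrix.vecMulVec v u - Matrix.vecMulVec u v

theorem planeGen_transpose (u v : Fin p → ℝ) : (planeGen u v)ᵀ = -planeGen u v := by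
  rw [planeGen, Matrix.transpose_sub, Matrix.transpose_vecMulVec, Matrix.transpose_vecMulVec,
    neg_sub]

variable {u v : Fin p → ℝ}

theorem planeGen_mul_self (hu : u ⬝ᵥ u = 1) (hv : v ⬝ᵥ v = 1) (huv : u ⬝ᵥ v = 0) :
    planeGen u v * planeGen u v = -(Matrix.vecMulVec u u + Matrix.vecMulVec v v) := by
  have hvu : v ⬝ᵥ u = 0 := by rw [dotProduct_comm, huv]
  simp only [planeGen, sub_mul, mul_sub, Matrix.vecMulVec_mul_vecMulVec, hu, hv, huv, hvu]
  simp
  abel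

theorem planeGen_cube (hu : u ⬝ᵥ u = 1) (hv : v ⬝ᵥ v = 1) (huv : u ⬝ᵥ v = 0) :
    planeGen u v * planeGen u v * planeGen u v = -planeGen u v := by
  have hvu : v ⬝ᵥ u = 0 := by rw [dotProduct_comm, huv]
  rw [planeGen_mul_self hu hv huv]
  simp only [planeGen, neg_mul, add_mul, mul_sub, Matrix.vecMulVec_mul_vecMulVec, hu, hv, huv, hvu]
  simp
  abel

theorem metric_planeGen (hu : u ⬝ᵥ u = 1) (hv : v ⬝ᵥ v = 1) (huv : u ⬝ᵥ v = 0) :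
    metric (planeGen u v) (planeGen u v) = 1 := by
  rw [metric_skew (planeGen_transpose u v), planeGen_mul_self hu hv huv, Matrix.trace_neg,
    Matrix.trace_add, Matrix.trace_vecMulVec, Matrix.trace_vecMulVec, hu, hv]
  norm_num

end RankTwo

/-! ### Jensen's inequality for positive semidefinite matrices of bounded rank. -/

section Spectral

variable {p : ℕ}

theorem trace_pow_eq_sum_eigenvalues {M : Matrix (Fin p) (Fin p) ℝ} (hM : M.IsHermitian) (k : ℕ) :
    (M ^ k).trace = ∑ i, hM.eigenvalues i ^ k := by
  conv_lhs => rw [hM.spectral_theorem, ← map_pow, Unitary.conjStarAlgAut_apply,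
    Matrix.trace_mul_cycle, Unitary.coe_star_mul_self, one_mul, Matrix.diagonal_pow,
    Matrix.trace_diagonal]
  simp

/-- Power mean inequality over the nonzero eigenvalues. Replacing their number by the larger `r`
only decreases the left side. -/
theorem card_mul_pow_le_trace_pow {M : Matrix (Fin p) (Fin p) ℝ} (hM : M.PosSemidef) {r : ℕ}
    (hr : M.rank ≤ r) (k : ℕ) :
    (r : ℝ) * (M.trace / r) ^ (k + 1) ≤ (M ^ (k + 1)).trace := by
  classical
  have hH := hM.isHermitian
  set s : Finset (Fin p) := Finset.univ.filter fun i => hH.eigenvalues i ≠ 0 with hs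
  have hcard : s.card ≤ r := by
    rw [hH.rank_eq_card_non_zero_eigs, Fintype.card_subtype] at hr
    exact hr
  have hsum : ∀ j : ℕ, (M ^ (j + 1)).trace = ∑ i ∈ s, hH.eigenvalues i ^ (j + 1) := fun j => by
    rw [trace_pow_eq_sum_eigenvalues hH, hs, Finset.sum_filter_of_ne]
    intro i _ hi h0
    rw [h0] at hi
    simp at hi
  have htr : M.trace = ∑ i ∈ s, hH.eigenvalues i := by simpa using hsum 0
  have hn : ∀ i ∈ s, 0 ≤ hH.eigenvalues i := fun i _ => hM.eigenvalues_nonneg i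
  rw [hsum, htr]
  rcases s.eq_empty_or_nonempty with h0 | h0
  · rw [h0]; simp
  · have hpos : (0 : ℝ) < s.card := by exact_mod_cast h0.card_pos
    have hle : (s.card : ℝ) ≤ r := by exact_mod_cast hcard
    have hr0 : (0 : ℝ) < r := hpos.trans_le hle
    refine le_trans ?_ (pow_sum_div_card_le_sum_pow hn k)
    have e : (r : ℝ) * ((∑ i ∈ s, hH.eigenvalues i) / r) ^ (k + 1)
        = (∑ i ∈ s, hH.eigenvalues i) ^ (k + 1) / (r : ℝ) ^ k := by
      rw [div_pow, pow_succ (r : ℝ)]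
      field_simp
    rw [e]
    exact div_le_div_of_nonneg_left (pow_nonneg (Finset.sum_nonneg hn) _) (pow_pos hpos _)
      (pow_le_pow_left₀ hpos.le hle _)

theorem card_mul_eval_le_trace_aeval {M : Matrix (Fin p) (Fin p) ℝ} (hM : M.PosSemidef) {r : ℕ}
    (hr : M.rank ≤ r) (N : ℕ) :
    (r : ℝ) * (arccosSq N).eval (M.trace / r) ≤ (Polynomial.aeval M (arccosSq N)).trace := by
  rw [trace_aeval, Polynomial.eval_eq_sum_range, Finset.mul_sum]
  refine Finset.sum_le_sum fun k _ => ?_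
  rcases k with _ | k
  · simp [arccosSq_coeff_zero]
  · rw [mul_left_comm]
    exact mul_le_mul_of_nonneg_left (card_mul_pow_le_trace_pow hM hr k)
      (arccosSq_coeff_nonneg N _)

theorem rank_add_le (A B : Matrix (Fin p) (Fin p) ℝ) : (A + B).rank ≤ A.rank + B.rank := by
  rw [Matrix.rank, Matrix.mulVecLin_add]
  refine le_trans (Submodule.finrank_mono ?_) (Submodule.finrank_add_le_finrank_add_finrank _ _)
  rintro _ ⟨x, rfl⟩
  exact Submodule.add_mem_sup ⟨x, rfl⟩ ⟨x, rfl⟩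

theorem rank_smul_le (c : ℝ) (A : Matrix (Fin p) (Fin p) ℝ) : (c • A).rank ≤ A.rank := by
  rw [← mul_one A, ← Matrix.mul_smul, mul_one]
  exact Matrix.rank_mul_le_left _ _

end Spectral

/-! ### Even sign changes and curves joining them to the identity. -/

section SignChangeMatrices

variable {p : ℕ}

theorem exists_curve_mul {U V : SO p}
    (hU : ∃ δ : ℝ → SO p, ContDiffOn ℝ 1 (toCurve δ) (Set.Icc 0 1) ∧ δ 0 = 1 ∧ δ 1 = U)
    (hV : ∃ δ : ℝ → SO p, ContDiffOn ℝ 1 (toCurve δ) (Set.Icc 0 1) ∧ δ 0 = 1 ∧ δ 1 = V) :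
    ∃ δ : ℝ → SO p, ContDiffOn ℝ 1 (toCurve δ) (Set.Icc 0 1) ∧ δ 0 = 1 ∧ δ 1 = U * V := by
  obtain ⟨δ, hδ, h0, rfl⟩ := hU
  obtain ⟨ε, hε, h0', rfl⟩ := hV
  exact ⟨fun t => δ t * ε t, hδ.mul hε, by simp [h0, h0'], rfl⟩

theorem exists_curve_exp {A : Matrix (Fin p) (Fin p) ℝ} (hA : Aᵀ = -A) :
    ∃ δ : ℝ → SO p, ContDiffOn ℝ 1 (toCurve δ) (Set.Icc 0 1) ∧ δ 0 = 1 ∧ δ 1 = expSO A hA :=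
  ⟨expCurve 1 A hA, (contDiff_expCurve 1 A hA (n := 1)).contDiffOn, expCurve_zero 1 A hA,
    expCurve_one hA (by simp [expSO])⟩

open Classical in
/-- The indices at which a sign vector is negative. -/
noncomputable def negIndices (σ : Fin p → ℝ) : Finset (Fin p) :=
  Finset.univ.filter fun i => σ i = -1

theorem mem_negIndices {σ : Fin p → ℝ} {i : Fin p} : i ∈ negIndices σ ↔ σ i = -1 := by
  simp [negIndices]

theorem prod_eq_neg_one_pow {σ : Fin p → ℝ} (hσ : ∀ i, σ i = 1 ∨ σ i = -1) :
    ∏ i, σ i = (-1) ^ (negIndices σ).card := by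
  classical
  rw [Finset.prod_congr rfl (g := fun i => if σ i = -1 then (-1 : ℝ) else 1), Finset.prod_ite]
  · simp only [Finset.prod_const, one_pow, mul_one, negIndices]
  · intro i _
    rcases hσ i with h | h <;> rw [h] <;> norm_num

theorem even_card_negIndices {σ : Fin p → ℝ} (hσ : ∀ i, σ i = 1 ∨ σ i = -1) (h : ∏ i, σ i = 1) :
    Even (negIndices σ).card := by
  rw [prod_eq_neg_one_pow hσ] at h
  exact (neg_one_pow_eq_one_iff_even (by norm_num)).1 h

theorem eq_one_of_negIndices_eq_empty {σ : Fin p → ℝ} (hσ : ∀ i, σ i = 1 ∨ σ i = -1)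
    (h : negIndices σ = ∅) : σ = 1 := by
  funext i
  refine (hσ i).resolve_right fun hi => ?_
  have := mem_negIndices.2 hi
  simp [h] at this

/-- Negative signs come in pairs, and each pair is removed by a half-turn in its coordinate plane.
The curve ensures that the lower bound for `dist` is not spoiled by an empty infimum. -/
theorem exists_curve_diagonal (n : ℕ) : ∀ (σ : Fin p → ℝ), (∀ i, σ i = 1 ∨ σ i = -1) →
    ∏ i, σ i = 1 → (negIndices σ).card ≤ n → ∀ S : SO p, S.1 = Matrix.diagonal σ →
    ∃ δ : ℝ → SO p, ContDiffOn ℝ 1 (toCurve δ) (Set.Icc 0 1) ∧ δ 0 = 1 ∧ δ 1 = S := by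
  have hone : ∀ (σ : Fin p → ℝ), (∀ i, σ i = 1 ∨ σ i = -1) → negIndices σ = ∅ →
      ∀ S : SO p, S.1 = Matrix.diagonal σ →
      ∃ δ : ℝ → SO p, ContDiffOn ℝ 1 (toCurve δ) (Set.Icc 0 1) ∧ δ 0 = 1 ∧ δ 1 = S := by
    intro σ hσ h S hS
    refine ⟨fun _ => 1, contDiffOn_const, rfl, Subtype.ext ?_⟩
    rw [hS, eq_one_of_negIndices_eq_empty hσ h]
    exact Matrix.diagonal_one.symm
  induction n with
  | zero => exact fun σ hσ _ h => hone σ hσ (Finset.card_eq_zero.1 (Nat.le_zero.1 h))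
  | succ n ih =>
    intro σ hσ hprod hcard S hS
    rcases (negIndices σ).eq_empty_or_nonempty with he | hne
    · exact hone σ hσ he S hS
    · have h2 : 1 < (negIndices σ).card := by
        obtain ⟨m, hm⟩ := even_card_negIndices hσ hprod
        have := hne.card_pos
        omega
      obtain ⟨i, hi, j, hj, hij⟩ := Finset.one_lt_card.1 h2
      set τ : Fin p → ℝ := fun k => if k = i ∨ k = j then -1 else 1 with hτ
      have hprodτ : ∏ k, τ k = 1 := by
        have : ∀ k, τ k = (if k = i then -1 else 1) * (if k = j then -1 else 1) := fun k => by
          simp only [hτ]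
          by_cases h1 : k = i
          · simp [h1, hij]
          · simp [h1]
        rw [Finset.prod_congr rfl fun k _ => this k, Finset.prod_mul_distrib]
        simp
      have hu : (Pi.single i (1 : ℝ) : Fin p → ℝ) ⬝ᵥ Pi.single i 1 = 1 := by simp
      have hv : (Pi.single j (1 : ℝ) : Fin p → ℝ) ⬝ᵥ Pi.single j 1 = 1 := by simp
      have huv : (Pi.single i (1 : ℝ) : Fin p → ℝ) ⬝ᵥ Pi.single j 1 = 0 := by simp [hij]
      have hexp : NormedSpace.exp (Real.pi • planeGen (Pi.single i (1 : ℝ)) (Pi.single j 1))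
          = Matrix.diagonal τ := by
        rw [exp_pi_smul_of_cube (planeGen_cube hu hv huv), planeGen_mul_self hu hv huv]
        have hs : ∀ l : Fin p, Matrix.vecMulVec (Pi.single l (1 : ℝ)) (Pi.single l 1)
            = Matrix.diagonal (Pi.single l (1 : ℝ)) := fun l => by
          ext a b
          rw [Matrix.vecMulVec_apply, Matrix.diagonal_apply]
          by_cases h : a = b
          · subst h; by_cases h' : a = l <;> simp [h']
          · by_cases h' : a = l
            · subst h'; simp [h, Ne.symm h]
            · simp [h, h']
        rw [hs, hs, ← Matrix.diagonal_one, Matrix.diagonal_add, Matrix.diagonal_neg,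
          ← Matrix.diagonal_smul, Matrix.diagonal_add]
        congr 1
        funext k
        simp only [hτ, Pi.smul_apply, Pi.single_apply, smul_eq_mul]
        by_cases h1 : k = i
        · have : k ≠ j := fun h => hij (h1.symm.trans h)
          simp [h1, hij]; norm_num
        · by_cases h2 : k = j
          · simp [h2, hij.symm]; norm_num
          · simp [h1, h2]
      have hττ : ∀ k, τ k * τ k = 1 := fun k => by
        simp only [hτ]; split_ifs <;> norm_num
      set ρ : Fin p → ℝ := fun k => σ k * τ k with hρ
      set R : SO p := expSO _ (smul_skew (planeGen_transpose (Pi.single i (1 : ℝ))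
        (Pi.single j 1)) Real.pi) with hR
      have hR1 : R.1 = Matrix.diagonal τ := hexp
      have hRR : R * R = 1 := by
        apply Subtype.ext
        change R.1 * R.1 = 1
        rw [hR1, Matrix.diagonal_mul_diagonal]
        simp [hττ]
      have hSR : (S * R).1 = Matrix.diagonal ρ := by
        change S.1 * R.1 = _
        rw [hR1, hS, Matrix.diagonal_mul_diagonal]
      have hρσ : ∀ k, ρ k = 1 ∨ ρ k = -1 := fun k => by
        simp only [hρ, hτ]
        rcases hσ k with h | h <;> rw [h] <;> split_ifs <;> norm_num
      have hsub : negIndices ρ ⊂ negIndices σ := by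
        refine Finset.ssubset_iff_of_subset (fun k hk => ?_) |>.2 ⟨i, hi, fun h => ?_⟩
        · rw [mem_negIndices] at hk hi hj ⊢
          simp only [hρ, hτ] at hk
          split_ifs at hk with h
          · rcases h with rfl | rfl <;> assumption
          · simpa using hk
        · rw [mem_negIndices] at h hi
          simp only [hρ, hτ, true_or, if_true, hi] at h
          norm_num at h
      have := ih ρ hρσ (by simp only [hρ]; rw [Finset.prod_mul_distrib, hprod, hprodτ, one_mul])
        (by have := Finset.card_lt_card hsub; omega) (S * R) hSR
      have h3 := exists_curve_mul this (exists_curve_exp (smul_skew (planeGen_transpose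
        (Pi.single i (1 : ℝ)) (Pi.single j 1)) Real.pi))
      rwa [← hR, mul_assoc, hRR, mul_one] at h3

theorem prod_eq_one_of_diagonal {S : SO p} {σ : Fin p → ℝ} (hS : S.1 = Matrix.diagonal σ) :
    ∏ i, σ i = 1 := by
  have := (Matrix.mem_specialOrthogonalGroup_iff.1 S.2).2
  rwa [hS, Matrix.det_diagonal] at this

/-- The lower bound for distances is available from every even sign-change matrix. -/
theorem sqDistTrunc_le_dist_sq_of_sign {S : SO p} {σ : Fin p → ℝ}
    (hσ : ∀ i, σ i = 1 ∨ σ i = -1) (hS : S.1 = Matrix.diagonal σ)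
    {A : Matrix (Fin p) (Fin p) ℝ} (hA : Aᵀ = -A) (N : ℕ) :
    sqDistTrunc N ((S.1)ᵀ * NormedSpace.exp A) ≤ dist S (expSO A hA) ^ 2 := by
  have hSS : S * S = 1 := by
    apply Subtype.ext
    change S.1 * S.1 = 1
    rw [hS, Matrix.diagonal_mul_diagonal]
    have : ∀ i, σ i * σ i = 1 := fun i => by rcases hσ i with h | h <;> rw [h] <;> norm_num
    simp [this]
  obtain ⟨δ, hδ, h0, h1⟩ := exists_curve_mul
    (exists_curve_diagonal _ σ hσ (prod_eq_one_of_diagonal hS) le_rfl S hS) (exists_curve_exp hA)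
  have hδ' : ContDiffOn ℝ 1 (toCurve fun t => S * δ t) (Set.Icc 0 1) :=
    contDiffOn_const.mul hδ
  exact (Real.sqrt_le_left (dist_nonneg _ _)).1 (sqrt_sqDistTrunc_le_dist N (V := expSO A hA) hδ'
    (by simp [h0]) (by rw [h1, ← mul_assoc, hSS, one_mul]))

end SignChangeMatrices

/-! ### An irreducible antipodal pair for `p ≥ 11`. -/

section Irreducible

variable {p : ℕ}

/-- The argument `36 / 11` is `4 - 8 / p` at `p = 11`, the mean nonzero-part eigenvalue for two sign
changes. At `p = 10` the bound fails even for the full series: `2 arccos (-3/5) ^ 2 < π ^ 2`. -/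
theorem pi_sq_lt_eval_six : Real.pi ^ 2 < 2 * (arccosSq 6).eval (36 / 11) := by
  have h1 := Real.pi_lt_d4
  have h2 := Real.pi_pos
  have h3 : Real.pi ^ 2 < 9.87 := by nlinarith
  refine h3.trans ?_
  simp only [arccosSq, Finset.sum_range_succ, Finset.sum_range_zero,
    Nat.centralBinom_eq_two_mul_choose]
  norm_num [Nat.choose]

/-- The argument `28 / 11` is `4 - 16 / p` at `p = 11`, a lower bound for the mean with any number
of sign changes; the factor `3` comes from at least four of them. -/
theorem pi_sq_lt_eval_six' : Real.pi ^ 2 < 3 * (arccosSq 6).eval (28 / 11) := by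
  have h1 := Real.pi_lt_d4
  have h2 := Real.pi_pos
  have h3 : Real.pi ^ 2 < 9.87 := by nlinarith
  refine h3.trans ?_
  simp only [arccosSq, Finset.sum_range_succ, Finset.sum_range_zero,
    Nat.centralBinom_eq_two_mul_choose]
  norm_num [Nat.choose]

theorem chord_mul_reflections {P Q : Matrix (Fin p) (Fin p) ℝ} (hP : P * P = P) (hQ : Q * Q = Q)
    (hPt : Pᵀ = P) (hQt : Qᵀ = Q) :
    chord ((1 - (2 : ℝ) • Q) * (1 - (2 : ℝ) • P)) = (4 : ℝ) • ((P - Q) * (P - Q)) := by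
  rw [chord, Matrix.transpose_mul, Matrix.transpose_sub, Matrix.transpose_sub,
    Matrix.transpose_smul, Matrix.transpose_smul, hPt, hQt, Matrix.transpose_one,
    ← one_add_one_eq_two]
  simp only [sub_mul, mul_sub, one_mul, mul_one, smul_mul_assoc, mul_smul_comm, hP, hQ]
  module

/-- An orthonormal pair of vectors spanning a plane that makes the same angle with all coordinate
axes. -/
theorem exists_balanced_plane (hp : 3 ≤ p) : ∃ u v : Fin p → ℝ,
    u ⬝ᵥ u = 1 ∧ v ⬝ᵥ v = 1 ∧ u ⬝ᵥ v = 0 ∧ ∀ i, u i * u i + v i * v i = 2 / p := by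
  have hp0 : (0 : ℝ) < p := by exact_mod_cast (by omega : 0 < p)
  have hp3 : (3 : ℝ) ≤ p := by exact_mod_cast hp
  -- The vectors have coordinates proportional to `cos (2πi/p)` and `sin (2πi/p)`. Their products
  -- involve the doubled angle `a i`, whose cosines and sines sum to `0`; `p ≥ 3` ensures `sin (a /
  -- 2) ≠ 0`.
  set a : ℝ := 4 * Real.pi / p with ha
  have hs : Real.sin (a / 2) ≠ 0 := by
    refine (Real.sin_pos_of_pos_of_lt_pi ?_ ?_).ne'
    · have := Real.pi_pos; positivity
    · rw [ha, div_div, div_lt_iff₀ (by positivity)]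
      nlinarith [Real.pi_pos]
  have hpa : (p : ℝ) * a / 2 = 2 * Real.pi := by rw [ha]; field_simp; ring
  have hcos : ∑ i : Fin p, Real.cos (a * (i : ℕ)) = 0 := by
    have := Real.sin_mul_sum_cos p a 0
    rw [hpa, Real.sin_two_pi, zero_mul] at this
    rw [Fin.sum_univ_eq_sum_range (fun i : ℕ => Real.cos (a * i)) p]
    simpa using (mul_eq_zero.1 this).resolve_left hs
  have hsin : ∑ i : Fin p, Real.sin (a * (i : ℕ)) = 0 := by
    have := Real.sin_mul_sum_sin p a 0
    rw [hpa, Real.sin_two_pi, zero_mul] at this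
    rw [Fin.sum_univ_eq_sum_range (fun i : ℕ => Real.sin (a * i)) p]
    simpa using (mul_eq_zero.1 this).resolve_left hs
  set r : ℝ := √(2 / p) with hr
  have hrr : r * r = 2 / p := Real.mul_self_sqrt (by positivity)
  have h2 : ∀ i : ℕ, a * (i : ℝ) = 2 * (a / 2 * i) := fun i => by ring
  refine ⟨fun i => r * Real.cos (a / 2 * (i : ℕ)), fun i => r * Real.sin (a / 2 * (i : ℕ)),
    ?_, ?_, ?_, fun i => ?_⟩
  · have : ∀ i : Fin p, r * Real.cos (a / 2 * (i : ℕ)) * (r * Real.cos (a / 2 * (i : ℕ)))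
        = 1 / p + 1 / p * Real.cos (a * (i : ℕ)) := fun i => by
      rw [h2, Real.cos_two_mul, mul_mul_mul_comm, hrr]; ring
    simp only [dotProduct, this]
    rw [Finset.sum_add_distrib, ← Finset.mul_sum, hcos]
    simp [hp0.ne']
  · have : ∀ i : Fin p, r * Real.sin (a / 2 * (i : ℕ)) * (r * Real.sin (a / 2 * (i : ℕ)))
        = 1 / p - 1 / p * Real.cos (a * (i : ℕ)) := fun i => by
      rw [h2, Real.cos_two_mul, mul_mul_mul_comm, hrr, Real.cos_sq']; ring
    simp only [dotProduct, this]
    rw [Finset.sum_sub_distrib, ← Finset.mul_sum, hcos]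
    simp [hp0.ne']
  · have : ∀ i : Fin p, r * Real.cos (a / 2 * (i : ℕ)) * (r * Real.sin (a / 2 * (i : ℕ)))
        = 1 / p * Real.sin (a * (i : ℕ)) := fun i => by
      rw [h2, Real.sin_two_mul, mul_mul_mul_comm, hrr]; ring
    simp only [dotProduct, this]
    rw [← Finset.mul_sum, hsin, mul_zero]
  · have := Real.cos_sq_add_sin_sq (a / 2 * (i : ℕ))
    linear_combination r * r * this + hrr

theorem pi_sq_lt_sqDistTrunc (hp : 11 ≤ p) {u v : Fin p → ℝ} (hu : u ⬝ᵥ u = 1) (hv : v ⬝ᵥ v = 1)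
    (huv : u ⬝ᵥ v = 0) (hbal : ∀ i, u i * u i + v i * v i = 2 / p) {σ : Fin p → ℝ}
    (hσ : ∀ i, σ i = 1 ∨ σ i = -1) (hprod : ∏ i, σ i = 1) (hne : (negIndices σ).Nonempty) :
    Real.pi ^ 2
      < sqDistTrunc 6 ((Matrix.diagonal σ)ᵀ * NormedSpace.exp (Real.pi • planeGen u v)) := by
  have hvu : v ⬝ᵥ u = 0 := by rw [dotProduct_comm, huv]
  set n := (negIndices σ).card with hn
  have hn2 : 2 ≤ n ∧ (n ≠ 2 → 4 ≤ n) := by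
    obtain ⟨m, hm⟩ := even_card_negIndices hσ hprod
    have := hne.card_pos
    omega
  have hpR : (11 : ℝ) ≤ p := by exact_mod_cast hp
  have hp0 : (0 : ℝ) < p := by linarith
  have hnR : (2 : ℝ) ≤ n := by exact_mod_cast hn2.1
  set P := Matrix.vecMulVec u u + Matrix.vecMulVec v v with hPdef
  set q : Fin p → ℝ := fun i => (1 - σ i) / 2 with hq
  set Q := Matrix.diagonal q with hQdef
  have hqv : ∀ i, q i = if i ∈ negIndices σ then 1 else 0 := fun i => by
    simp only [hq, mem_negIndices]
    rcases hσ i with h | h <;> rw [h] <;> norm_num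
  have hqsum : ∑ i, q i = n := by
    simp [hqv, hn]
  have hW : NormedSpace.exp (Real.pi • planeGen u v) = 1 - (2 : ℝ) • P := by
    rw [exp_pi_smul_of_cube (planeGen_cube hu hv huv), planeGen_mul_self hu hv huv]
    module
  have hS : Matrix.diagonal σ = 1 - (2 : ℝ) • Q := by
    rw [hQdef, ← Matrix.diagonal_one, ← Matrix.diagonal_smul, Matrix.diagonal_sub]
    congr 1
    funext i
    simp only [hq, Pi.smul_apply, smul_eq_mul]
    ring
  have hPP : P * P = P := by
    simp only [hPdef, add_mul, mul_add, Matrix.vecMulVec_mul_vecMulVec, hu, hv, huv, hvu]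
    simp
  have hQQ : Q * Q = Q := by
    rw [hQdef, Matrix.diagonal_mul_diagonal]
    congr 1
    funext i
    rw [hqv]
    split_ifs <;> norm_num
  have hPt : Pᵀ = P := by
    rw [hPdef, Matrix.transpose_add, Matrix.transpose_vecMulVec, Matrix.transpose_vecMulVec]
  have hQt : Qᵀ = Q := Matrix.diagonal_transpose q
  set M := (4 : ℝ) • ((P - Q) * (P - Q)) with hM
  have hMpsd : M.PosSemidef := by
    have : (P - Q)ᴴ = P - Q := by
      rw [Matrix.conjTranspose_eq_transpose_of_trivial, Matrix.transpose_sub, hPt, hQt]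
    have h := Matrix.posSemidef_conjTranspose_mul_self (P - Q)
    rw [this] at h
    exact h.smul (by norm_num)
  have hrank : M.rank ≤ 2 + n := by
    have hP2 : P.rank ≤ 2 := (rank_add_le _ _).trans
      (Nat.add_le_add (Matrix.rank_vecMulVec_le _ _) (Matrix.rank_vecMulVec_le _ _))
    have hQn : Q.rank ≤ n := by
      classical
      rw [hQdef, Matrix.rank_diagonal, Fintype.card_subtype, hn]
      refine Finset.card_le_card fun i hi => ?_
      by_contra h
      simp [hqv, h] at hi
    have hPQ : (P - Q).rank ≤ P.rank + Q.rank := by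
      have := rank_add_le P ((-1 : ℝ) • Q)
      rw [neg_one_smul, ← sub_eq_add_neg] at this
      have h2 := rank_smul_le (-1) Q
      rw [neg_one_smul] at h2
      omega
    have := (rank_smul_le 4 ((P - Q) * (P - Q))).trans (Matrix.rank_mul_le_left _ _)
    rw [← hM] at this
    omega
  -- Balance of the plane makes the trace depend only on the number `n` of sign changes, not on
  -- their positions.
  have htrace : M.trace = 4 * (2 + n - 2 * (n * (2 / p))) := by
    have hPQ : (P * Q).trace = n * (2 / p) := by
      have hPii : ∀ i, P i i = 2 / p := fun i => by
        simp [hPdef, Matrix.vecMulVec_apply, hbal]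
      rw [hQdef]
      simp only [Matrix.trace, Matrix.diag, Matrix.mul_diagonal, hPii]
      rw [← Finset.mul_sum, hqsum, mul_comm]
    have hPtr : P.trace = 2 := by
      rw [hPdef, Matrix.trace_add, Matrix.trace_vecMulVec, Matrix.trace_vecMulVec, hu, hv]
      norm_num
    have hQtr : Q.trace = n := by rw [hQdef, Matrix.trace_diagonal, hqsum]
    rw [hM, Matrix.trace_smul, sub_mul, mul_sub, mul_sub, hPP, hQQ, Matrix.trace_sub,
      Matrix.trace_sub, Matrix.trace_sub, Matrix.trace_mul_comm Q P, hPQ, hPtr, hQtr, smul_eq_mul]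
    ring
  have hlow := card_mul_eval_le_trace_aeval hMpsd hrank 6
  have hge : ∀ x : ℝ, 0 ≤ x → x * (2 + n) ≤ M.trace →
      (2 + n : ℝ) * (arccosSq 6).eval x ≤ (Polynomial.aeval M (arccosSq 6)).trace := by
    intro x hx hxM
    refine le_trans ?_ hlow
    push_cast
    refine mul_le_mul_of_nonneg_left (eval_mono_of_coeff_nonneg (arccosSq_coeff_nonneg 6) hx ?_)
      (by positivity)
    rwa [le_div_iff₀ (by positivity)]
  have h2p : (2 : ℝ) / p ≤ 2 / 11 := div_le_div_of_nonneg_left (by norm_num) (by norm_num) hpR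
  rw [Matrix.diagonal_transpose, hW, hS, sqDistTrunc, chord_mul_reflections hPP hQQ hPt hQt, ← hM]
  by_cases h : n = 2
  · have hn' : (n : ℝ) = 2 := by exact_mod_cast h
    have := hge (36 / 11) (by norm_num) (by rw [htrace, hn']; linarith)
    rw [hn'] at this
    linarith [pi_sq_lt_eval_six]
  · have hn' : (4 : ℝ) ≤ n := by exact_mod_cast hn2.2 h
    have := hge (28 / 11) (by norm_num) (by rw [htrace]; nlinarith)
    have h0 : 0 ≤ (arccosSq 6).eval (28 / 11) :=
      eval_nonneg_of_coeff_nonneg (arccosSq_coeff_nonneg 6) (by norm_num)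
    nlinarith [pi_sq_lt_eval_six']

theorem exists_antipodal_not_reducible (hp : 11 ≤ p) :
    ∃ U V : SO p, GeodesicallyAntipodal U V ∧ ¬ SignChangeReducible U V := by
  obtain ⟨u, v, hu, hv, huv, hbal⟩ := exists_balanced_plane (p := p) (by omega)
  have hA := planeGen_transpose u v
  have hJ := planeGen_cube hu hv huv
  have h1 := metric_planeGen hu hv huv
  have hV : expCurve 1 (planeGen u v) hA Real.pi = expSO _ (smul_skew hA Real.pi) := one_mul _
  have hd : dist 1 (expSO _ (smul_skew hA Real.pi)) = Real.pi := by
    rw [← hV]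
    exact dist_expCurve_of_le_pi 1 hA hJ h1 Real.pi_pos le_rfl
  refine ⟨1, expSO _ (smul_skew hA Real.pi), Or.inl ?_, ?_⟩
  · rw [← hV]
    exact mem_cutLocus_expCurve hA h1 ((isLUB_minimizing_of_cube 1 hA hJ h1).2 rfl)
  · rintro ⟨S, ⟨σ, hσ, hS⟩, hlt⟩
    rw [one_mul, hd] at hlt
    rcases (negIndices σ).eq_empty_or_nonempty with he | hne
    · have : S = 1 := Subtype.ext (by
        rw [hS, eq_one_of_negIndices_eq_empty hσ he]; exact Matrix.diagonal_one)
      rw [this, hd] at hlt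
      exact hlt.false
    · have hlow := sqDistTrunc_le_dist_sq_of_sign hσ hS (smul_skew hA Real.pi) 6
      rw [hS] at hlow
      have := pi_sq_lt_sqDistTrunc hp hu hv huv hbal hσ (prod_eq_one_of_diagonal hS) hne
      have h0 := dist_nonneg S (expSO _ (smul_skew hA Real.pi))
      nlinarith

end Irreducible

/-! ### Reducibility for `p ≤ 3`. -/

section Reduction

variable {p : ℕ}

theorem reducible_of_exp {U V : SO p} {σ : Fin p → ℝ} (hσ : ∀ i, σ i = 1 ∨ σ i = -1)
    (hprod : ∏ i, σ i = 1) {B : Matrix (Fin p) (Fin p) ℝ} (hB : Bᵀ = -B)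
    (h : Matrix.diagonal σ * ((U.1)ᵀ * V.1) = NormedSpace.exp B)
    (hlt : metric B B < dist U V ^ 2) : SignChangeReducible U V := by
  have hmem : Matrix.diagonal σ ∈ Matrix.specialOrthogonalGroup (Fin p) ℝ := by
    refine Matrix.mem_specialOrthogonalGroup_iff.2
      ⟨(Matrix.mem_orthogonalGroup_iff (Fin p) ℝ).2 ?_, by rw [Matrix.det_diagonal, hprod]⟩
    rw [Matrix.diagonal_transpose, Matrix.diagonal_mul_diagonal]
    have : ∀ i, σ i * σ i = 1 := fun i => by rcases hσ i with h | h <;> rw [h] <;> norm_num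
    simp [this]
  refine ⟨⟨_, hmem⟩, ⟨σ, hσ, rfl⟩, ?_⟩
  have hle : dist (U * ⟨_, hmem⟩) V ≤ √(metric B B) := by
    refine dist_le_of_exp hB ?_
    rw [← h]
    change (U.1 * Matrix.diagonal σ)ᵀ * V.1 = _
    rw [Matrix.transpose_mul, Matrix.diagonal_transpose, mul_assoc]
  exact hle.trans_lt ((Real.sqrt_lt' (by
    by_contra h0
    have := (dist_nonneg U V).antisymm' (not_lt.1 h0)
    rw [this] at hlt
    have := metric_self_nonneg B
    norm_num at hlt
    linarith)).2 hlt)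

theorem eq_expCurve {U V : SO p} {A : Matrix (Fin p) (Fin p) ℝ} (hA : Aᵀ = -A) {t : ℝ}
    (h : (U.1)ᵀ * V.1 = NormedSpace.exp (t • A)) : V = expCurve U A hA t := by
  apply Subtype.ext
  change V.1 = U.1 * NormedSpace.exp (t • A)
  rw [← h, ← mul_assoc, U.mul_transpose_self, one_mul]

theorem neg_skew {A : Matrix (Fin p) (Fin p) ℝ} (hA : Aᵀ = -A) : (-A)ᵀ = -(-A) := by
  rw [Matrix.transpose_neg, hA]

theorem transpose_mul_eq_exp_neg {U V : SO p} {A : Matrix (Fin p) (Fin p) ℝ} (hA : Aᵀ = -A) {t : ℝ}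
    (h : (V.1)ᵀ * U.1 = NormedSpace.exp (t • A)) :
    (U.1)ᵀ * V.1 = NormedSpace.exp (t • (-A)) := by
  have := congrArg Matrix.transpose h
  rwa [Matrix.transpose_mul, Matrix.transpose_transpose, ← Matrix.exp_transpose,
    Matrix.transpose_smul, hA] at this

/-- If `c A` is the cut time in the direction `A` from every point, then geodesically antipodal
points are joined by a geodesic of length `c A`. -/
theorem GeodesicallyAntipodal.exists_cutTime {U V : SO p} (h : GeodesicallyAntipodal U V)
    {c : Matrix (Fin p) (Fin p) ℝ → ℝ → Prop} (hc : ∀ (U : SO p) (A : Matrix (Fin p) (Fin p) ℝ)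
      (hA : Aᵀ = -A) (t : ℝ), metric A A = 1 →
      IsLUB {t : ℝ | 0 < t ∧ dist U (expCurve U A hA t) = t} t → c A t)
    (hneg : ∀ A t, c A t → c (-A) t) :
    ∃ (A : Matrix (Fin p) (Fin p) ℝ) (t : ℝ), Aᵀ = -A ∧ metric A A = 1 ∧ c A t ∧
      (U.1)ᵀ * V.1 = NormedSpace.exp (t • A) := by
  rcases h with h | h
  · obtain ⟨A, hA, t, h1, hlub, he⟩ := exists_of_mem_cutLocus h
    exact ⟨A, t, hA, h1, hc U A hA t h1 hlub, he⟩
  · obtain ⟨A, hA, t, h1, hlub, he⟩ := exists_of_mem_cutLocus h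
    refine ⟨-A, t, neg_skew hA, ?_, hneg _ _ (hc V A hA t h1 hlub), transpose_mul_eq_exp_neg hA he⟩
    rw [← h1, metric, metric, Matrix.transpose_neg, neg_mul_neg]

theorem antipodal_of_cube (hcube : ∀ A : Matrix (Fin p) (Fin p) ℝ, Aᵀ = -A → metric A A = 1 →
      A * A * A = -A) {U V : SO p} (h : GeodesicallyAntipodal U V) :
    dist U V = Real.pi ∧ ∃ A : Matrix (Fin p) (Fin p) ℝ, Aᵀ = -A ∧ metric A A = 1 ∧
      (U.1)ᵀ * V.1 = 1 + (2 : ℝ) • (A * A) := by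
  obtain ⟨A, t, hA, h1, rfl, he⟩ := h.exists_cutTime (c := fun _ t => t = Real.pi)
    (fun U A hA t h1 hlub => (isLUB_minimizing_of_cube U hA (hcube A hA h1) h1).1 hlub)
    fun _ _ h => h
  refine ⟨?_, A, hA, h1, ?_⟩
  · rw [eq_expCurve hA he]
    exact dist_expCurve_of_le_pi U hA (hcube A hA h1) h1 Real.pi_pos le_rfl
  · rw [he, exp_pi_smul_of_cube (hcube A hA h1)]

theorem skew_apply {A : Matrix (Fin p) (Fin p) ℝ} (hA : Aᵀ = -A) (i j : Fin p) :
    A i j = -A j i := congrFun (congrFun hA j) i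

theorem skew_diag {A : Matrix (Fin p) (Fin p) ℝ} (hA : Aᵀ = -A) (i : Fin p) : A i i = 0 := by
  have := skew_apply hA i i
  linarith

/-- Antisymmetric matrices vanish in these sizes, so there is no unit-speed geodesic and every
cut-locus is empty. -/
theorem not_antipodal_of_lt_two (hp : p < 2) (U V : SO p) : ¬ GeodesicallyAntipodal U V := by
  intro h
  obtain ⟨A, -, hA, h1, -⟩ := h.exists_cutTime (c := fun _ _ => True)
    (fun _ _ _ _ _ _ => trivial) fun _ _ h => h
  have h0 : A = 0 := by
    ext i j
    have : i = j := Fin.ext (by omega)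
    rw [this, skew_diag hA]
    rfl
  rw [h0] at h1
  simp [metric] at h1

theorem mul_self_of_skew_two {A : Matrix (Fin 2) (Fin 2) ℝ} (hA : Aᵀ = -A) (h1 : metric A A = 1) :
    A * A = -1 := by
  have h00 := skew_diag hA 0
  have h11 := skew_diag hA 1
  have h01 := skew_apply hA 0 1
  rw [metric_skew hA] at h1
  simp only [Matrix.trace, Matrix.diag, Matrix.mul_apply, Fin.sum_univ_two, h00, h11, h01] at h1
  ext i j
  fin_cases i <;> fin_cases j <;> simp [Matrix.mul_apply, Fin.sum_univ_two, h00, h11, h01] <;>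
    linarith

theorem reducible_two {U V : SO 2} (h : GeodesicallyAntipodal U V) : SignChangeReducible U V := by
  obtain ⟨hd, A, hA, h1, he⟩ := antipodal_of_cube (fun A hA h1 => by
    rw [mul_self_of_skew_two hA h1, neg_one_mul]) h
  refine reducible_of_exp (σ := fun _ => -1) (fun _ => Or.inr rfl) (by simp) (B := 0) (by simp) ?_ ?_
  · rw [he, mul_self_of_skew_two hA h1, NormedSpace.exp_zero]
    ext i j
    fin_cases i <;> fin_cases j <;> simp [Matrix.mul_apply, Fin.sum_univ_two] <;> norm_num
  · rw [hd]
    simpa [metric] using pow_pos Real.pi_pos 2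

/-- The product of two half-turns about axes that are not orthogonal. -/
theorem exists_exp_eq_mul_halfTurns {e w : Fin p → ℝ} (he : e ⬝ᵥ e = 1) (hw : w ⬝ᵥ w = 1)
    (hpos : 0 < e ⬝ᵥ w) : ∃ B : Matrix (Fin p) (Fin p) ℝ, Bᵀ = -B ∧ metric B B < Real.pi ^ 2 ∧
    ((2 : ℝ) • Matrix.vecMulVec e e - 1) * ((2 : ℝ) • Matrix.vecMulVec w w - 1)
      = NormedSpace.exp B := by
  set c := e ⬝ᵥ w with hc
  have hwe : w ⬝ᵥ e = c := dotProduct_comm _ _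
  set g := w - c • e with hg
  have heg : e ⬝ᵥ g = 0 := by
    rw [hg, dotProduct_sub, dotProduct_smul, he, ← hc]; simp
  have hgg : g ⬝ᵥ g = 1 - c ^ 2 := by
    rw [hg, sub_dotProduct, dotProduct_sub, dotProduct_sub, dotProduct_smul, smul_dotProduct,
      smul_dotProduct, dotProduct_smul, he, hw, hwe, ← hc]
    simp only [smul_eq_mul]; ring
  have hgn : 0 ≤ g ⬝ᵥ g := by
    simp only [dotProduct]; exact Finset.sum_nonneg fun i _ => mul_self_nonneg _
  have hc1 : c ≤ 1 := by nlinarith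
  have hcos := Real.cos_arccos (by linarith : -1 ≤ c) hc1
  have hsin := Real.sin_arccos c
  set φ := Real.arccos c with hφ
  have hφ0 : 0 ≤ φ := Real.arccos_nonneg c
  have hφ2 : φ < Real.pi / 2 := Real.arccos_lt_pi_div_two.2 hpos
  rcases hgn.eq_or_lt with h0 | h0
  · have hg0 : g = 0 := dotProduct_self_eq_zero.1 h0.symm
    have hwe' : w = e := by
      have hc1 : c = 1 := by nlinarith
      rw [hc1, one_smul] at hg
      rw [← sub_eq_zero, ← hg, hg0]
    refine ⟨0, by simp, by simpa [metric] using pow_pos Real.pi_pos 2, ?_⟩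
    rw [hwe', NormedSpace.exp_zero]
    simp only [sub_mul, mul_sub, smul_mul_smul_comm, Matrix.vecMulVec_mul_vecMulVec, he, one_mul,
      mul_one, one_smul]
    module
  · set s := √(1 - c ^ 2) with hs
    have hss : s * s = 1 - c ^ 2 := Real.mul_self_sqrt (by linarith)
    have hs0 : s ≠ 0 := by
      intro h; rw [h] at hss; linarith
    set f := s⁻¹ • g with hf
    have hff : f ⬝ᵥ f = 1 := by
      rw [hf, dotProduct_smul, smul_dotProduct, hgg, ← hss]
      simp only [smul_eq_mul]; field_simp
    have hfe : f ⬝ᵥ e = 0 := by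
      rw [hf, smul_dotProduct, dotProduct_comm, heg, smul_zero]
    have hef : e ⬝ᵥ f = 0 := by rw [dotProduct_comm, hfe]
    have hwf : w = c • e + s • f := by
      rw [hf, smul_smul, mul_inv_cancel₀ hs0, one_smul, hg]; abel
    -- The product of half-turns about axes at angle `φ` is the rotation by `2φ` in their plane, and
    -- `φ < π / 2`.
    refine ⟨(2 * φ) • planeGen f e, smul_skew (planeGen_transpose f e) _, ?_, ?_⟩
    · rw [metric_smul_smul, metric_planeGen hff he hfe]
      nlinarith [Real.pi_pos]
    · rw [exp_smul_of_cube (planeGen_cube hff he hfe), planeGen_mul_self hff he hfe,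
        Real.sin_two_mul, Real.cos_two_mul, hcos, hsin, hwf, planeGen]
      simp only [Matrix.vecMulVec_add, Matrix.add_vecMulVec, Matrix.smul_vecMulVec,
        Matrix.vecMulVec_smul, sub_mul, mul_sub, mul_add, smul_add, mul_smul_comm, smul_mul_assoc,
        Matrix.vecMulVec_mul_vecMulVec, he, hef, one_mul, mul_one, one_smul, zero_smul,
        Matrix.vecMulVec_zero]
      match_scalars <;> first | ring1 | linear_combination -2 * hss

/-- `A` is the cross product with the vector `w` whose coordinates are its entries. -/
theorem skew_three {A : Matrix (Fin 3) (Fin 3) ℝ} (hA : Aᵀ = -A) (h1 : metric A A = 1) :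
    ∃ w : Fin 3 → ℝ, w ⬝ᵥ w = 1 ∧ A * A = Matrix.vecMulVec w w - 1 := by
  have h00 := skew_diag hA 0
  have h11 := skew_diag hA 1
  have h22 := skew_diag hA 2
  have h01 := skew_apply hA 0 1
  have h02 := skew_apply hA 0 2
  have h12 := skew_apply hA 1 2
  rw [metric_skew hA] at h1
  simp only [Matrix.trace, Matrix.diag, Matrix.mul_apply, Fin.sum_univ_three, h00, h11, h22, h01,
    h02, h12] at h1
  refine ⟨![A 2 1, -A 2 0, A 1 0], ?_, ?_⟩
  · simp [dotProduct, Fin.sum_univ_three]; linarith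
  · ext i j
    fin_cases i <;> fin_cases j <;>
      simp [Matrix.mul_apply, Fin.sum_univ_three, h00, h11, h22, h01, h02, h12] <;>
      linarith

theorem cube_of_skew_three {A : Matrix (Fin 3) (Fin 3) ℝ} (hA : Aᵀ = -A) (h1 : metric A A = 1) :
    A * A * A = -A := by
  have h00 := skew_diag hA 0
  have h11 := skew_diag hA 1
  have h22 := skew_diag hA 2
  have h01 := skew_apply hA 0 1
  have h02 := skew_apply hA 0 2
  have h12 := skew_apply hA 1 2
  rw [metric_skew hA] at h1
  simp only [Matrix.trace, Matrix.diag, Matrix.mul_apply, Fin.sum_univ_three, h00, h11, h22, h01,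
    h02, h12] at h1
  ext i j
  have e0 := congrArg (fun x => x * A 1 0) h1
  have e1 := congrArg (fun x => x * A 2 0) h1
  have e2 := congrArg (fun x => x * A 2 1) h1
  fin_cases i <;> fin_cases j <;>
    simp [Matrix.mul_apply, Fin.sum_univ_three, h00, h11, h22, h01, h02, h12] <;>
    first | ring1 | linarith

theorem reducible_three {U V : SO 3} (h : GeodesicallyAntipodal U V) :
    SignChangeReducible U V := by
  obtain ⟨hd, A, hA, h1, he⟩ := antipodal_of_cube (fun A hA h1 => cube_of_skew_three hA h1) h
  obtain ⟨w, hw, hAw⟩ := skew_three hA h1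
  have hW : (U.1)ᵀ * V.1 = (2 : ℝ) • Matrix.vecMulVec w w - 1 := by
    rw [he, hAw]; module
  obtain ⟨i, hi⟩ : ∃ i, w i ≠ 0 := by
    by_contra! h0
    rw [show w = 0 from funext h0] at hw
    simp at hw
  -- The half-turn does not distinguish `w` from `-w`, so the axis can be oriented towards the
  -- `i`-th coordinate vector.
  obtain ⟨w', hw', hww, hpos⟩ : ∃ w' : Fin 3 → ℝ, w' ⬝ᵥ w' = 1 ∧
      Matrix.vecMulVec w w = Matrix.vecMulVec w' w' ∧ 0 < (Pi.single i (1 : ℝ)) ⬝ᵥ w' := by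
    rcases lt_or_gt_of_ne hi with hlt | hgt
    · exact ⟨-w, by simpa using hw, by simp [Matrix.neg_vecMulVec, Matrix.vecMulVec_neg],
        by simpa using hlt⟩
    · exact ⟨w, hw, rfl, by simpa using hgt⟩
  obtain ⟨B, hB, hBlt, hBe⟩ := exists_exp_eq_mul_halfTurns (by simp) hw' hpos
  refine reducible_of_exp (σ := fun k => if k = i then 1 else -1)
    (fun k => by split_ifs <;> simp) (by fin_cases i <;> simp [Fin.prod_univ_three])
    hB ?_ (by rwa [hd])
  rw [hW, hww, ← hBe]
  congr 1
  ext a b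
  fin_cases i <;> fin_cases a <;> fin_cases b <;> simp [Matrix.vecMulVec_apply] <;> norm_num

end Reduction

/-! ### Distances and cut times in `SO(4)` from commuting complex structures. -/

section CommutingStructures

variable {p : ℕ}

theorem arccosSq_eval_mono {N K : ℕ} (h : N ≤ K) {u : ℝ} (hu : 0 ≤ u) :
    (arccosSq N).eval u ≤ (arccosSq K).eval u := by
  refine monotone_nat_of_le_succ (f := fun N => (arccosSq N).eval u) (fun n => ?_) h
  simp only [arccosSq_succ, Polynomial.eval_add, Polynomial.eval_mul, Polynomial.eval_C,
    Polynomial.eval_pow, Polynomial.eval_X]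
  have : 0 ≤ 2 / (((n + 1 : ℕ) : ℝ) ^ 2 * (n + 1).centralBinom) * u ^ (n + 1) := by positivity
  linarith

/-- Monotonicity in the order decouples the two truncations, so that the limits can be taken one at
a time. -/
theorem sq_add_sq_le_of_arccosSq_add_le {θ ψ c : ℝ} (hθ : |θ| ≤ Real.pi) (hψ : |ψ| ≤ Real.pi)
    (h : ∀ N, (arccosSq N).eval (2 - 2 * Real.cos θ) + (arccosSq N).eval (2 - 2 * Real.cos ψ) ≤ c) :
    θ ^ 2 + ψ ^ 2 ≤ c := by
  have h' : ∀ N K, (arccosSq N).eval (2 - 2 * Real.cos θ)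
      + (arccosSq K).eval (2 - 2 * Real.cos ψ) ≤ c := fun N K =>
    (add_le_add
      (arccosSq_eval_mono (le_max_left N K) (by linarith [Real.cos_le_one θ]))
      (arccosSq_eval_mono (le_max_right N K) (by linarith [Real.cos_le_one ψ]))).trans (h _)
  have h1 : ∀ K, θ ^ 2 ≤ c - (arccosSq K).eval (2 - 2 * Real.cos ψ) := fun K => by
    rw [← sq_abs]
    refine sq_le_of_arccosSq_le (abs_nonneg θ) hθ fun N => ?_
    rw [Real.cos_abs]
    linarith [h' N K]
  have h2 : ψ ^ 2 ≤ c - θ ^ 2 := by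
    rw [← sq_abs ψ]
    refine sq_le_of_arccosSq_le (abs_nonneg ψ) hψ fun K => ?_
    rw [Real.cos_abs]
    linarith [h1 K]
  linarith

/-- Two commuting orthogonal complex structures on `ℝ⁴` of opposite orientations. -/
structure IsCommutingPair (P Q : Matrix (Fin 4) (Fin 4) ℝ) : Prop where
  left_skew : Pᵀ = -P
  right_skew : Qᵀ = -Q
  left_sq : P * P = -1
  right_sq : Q * Q = -1
  comm : P * Q = Q * P
  trace_mul : (P * Q).trace = 0

variable {P Q : Matrix (Fin 4) (Fin 4) ℝ}

theorem IsCommutingPair.skew (h : IsCommutingPair P Q) (a b : ℝ) :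
    (a • P + b • Q)ᵀ = -(a • P + b • Q) := by
  rw [Matrix.transpose_add, smul_skew h.left_skew, smul_skew h.right_skew]
  abel

theorem IsCommutingPair.metric (h : IsCommutingPair P Q) (a b : ℝ) :
    metric (a • P + b • Q) (a • P + b • Q) = 2 * (a ^ 2 + b ^ 2) := by
  have hQP : (Q * P).trace = 0 := by rw [← h.comm, h.trace_mul]
  rw [metric_skew (h.skew a b)]
  simp only [add_mul, mul_add, smul_mul_smul_comm, h.left_sq, h.right_sq, Matrix.trace_add,
    Matrix.trace_smul, h.trace_mul, hQP, Matrix.trace_neg, Matrix.trace_one, Fintype.card_fin,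
    smul_eq_mul]
  push_cast
  ring

theorem exp_smul_of_mul_self {P : Matrix (Fin p) (Fin p) ℝ} (h : P * P = -1) (a : ℝ) :
    NormedSpace.exp (a • P) = Real.cos a • 1 + Real.sin a • P := by
  rw [exp_smul_of_cube (by rw [h, neg_one_mul]), h]
  module

theorem IsCommutingPair.exp (h : IsCommutingPair P Q) (a b : ℝ) :
    NormedSpace.exp (a • P + b • Q)
      = (Real.cos a • 1 + Real.sin a • P) * (Real.cos b • 1 + Real.sin b • Q) := by
  have hc : Commute (a • P) (b • Q) := (Commute.smul_left h.comm a).smul_right b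
  rw [Matrix.exp_add_of_commute _ _ hc, exp_smul_of_mul_self h.left_sq,
    exp_smul_of_mul_self h.right_sq]

/-- `P Q` is an involution of trace zero. On its eigenspaces for `1` and `-1`, both of dimension
two, `Q` equals `-P` and `P`, so the rotation angles are `a - b` and `a + b`. -/
theorem IsCommutingPair.sqDistTrunc_exp (h : IsCommutingPair P Q) (N : ℕ) (a b : ℝ) :
    sqDistTrunc N (NormedSpace.exp (a • P + b • Q))
      = (arccosSq N).eval (2 - 2 * Real.cos (a - b))
        + (arccosSq N).eval (2 - 2 * Real.cos (a + b)) := by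
  set T := P * Q with hT
  have hTT : T * T = 1 := by
    rw [hT, mul_assoc, ← mul_assoc Q, ← h.comm, mul_assoc P Q, h.right_sq, mul_neg, mul_one,
      mul_neg, h.left_sq, neg_neg]
  set E := (1 / 2 : ℝ) • (1 + T) with hE
  set F := (1 / 2 : ℝ) • (1 - T) with hF
  have hEE : E * E = E := by
    simp only [hE, smul_mul_smul_comm, add_mul, mul_add, hTT, one_mul, mul_one]; module
  have hFF : F * F = F := by
    simp only [hF, smul_mul_smul_comm, sub_mul, mul_sub, hTT, one_mul, mul_one]; module
  have hEF : E * F = 0 := by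
    simp only [hE, hF, smul_mul_smul_comm, add_mul, mul_sub, hTT, one_mul, mul_one]; module
  have hFE : F * E = 0 := by
    simp only [hE, hF, smul_mul_smul_comm, sub_mul, mul_add, hTT, one_mul, mul_one]; module
  have hEt : E.trace = 2 := by
    rw [hE, Matrix.trace_smul, Matrix.trace_add, h.trace_mul, Matrix.trace_one]; norm_num
  have hFt : F.trace = 2 := by
    rw [hF, Matrix.trace_smul, Matrix.trace_sub, h.trace_mul, Matrix.trace_one]; norm_num
  set u := 2 - 2 * Real.cos (a - b) with hu
  set v := 2 - 2 * Real.cos (a + b) with hv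
  have hchord : chord (NormedSpace.exp (a • P + b • Q)) = u • E + v • F := by
    rw [chord, h.exp, Matrix.transpose_mul]
    simp only [Matrix.transpose_add, Matrix.transpose_smul, Matrix.transpose_one, h.left_skew,
      h.right_skew]
    rw [← one_add_one_eq_two, hu, hv, Real.cos_sub, Real.cos_add, hE, hF]
    simp only [add_mul, mul_add, smul_mul_smul_comm, one_mul, mul_one, neg_mul_neg, ← h.comm, ← hT]
    module
  have hpow : ∀ k : ℕ, (u • E + v • F) ^ (k + 1) = u ^ (k + 1) • E + v ^ (k + 1) • F := fun k => by
    induction k with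
    | zero => simp
    | succ k ih =>
      rw [pow_succ, ih]
      simp only [add_mul, mul_add, smul_mul_smul_comm, hEE, hFF, hEF, hFE, smul_zero, add_zero,
        zero_add, ← pow_succ]
  rw [sqDistTrunc, hchord, trace_aeval_arccosSq (a := 2) (b := 2) (u := u) (v := v)]
  · ring
  · intro k
    rw [hpow, Matrix.trace_add, Matrix.trace_smul _ E, Matrix.trace_smul _ F, hEt, hFt, smul_eq_mul,
      smul_eq_mul]
    ring

theorem IsCommutingPair.le_dist_sq (h : IsCommutingPair P Q) {a b : ℝ} (ha : 0 ≤ a) (hb : 0 ≤ b)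
    (hab : a + b ≤ Real.pi) {U V : SO 4}
    (he : (U.1)ᵀ * V.1 = NormedSpace.exp (a • P + b • Q)) :
    2 * (a ^ 2 + b ^ 2) ≤ dist U V ^ 2 := by
  have := sq_add_sq_le_of_arccosSq_add_le (θ := a - b) (ψ := a + b) (c := dist U V ^ 2)
    (abs_le.2 ⟨by linarith, by linarith⟩) (abs_le.2 ⟨by linarith, by linarith⟩) fun N => by
      rw [← h.sqDistTrunc_exp]
      exact le_dist_of_sqDistTrunc (h.skew a b) he N
  linarith

theorem IsCommutingPair.dist_sq_le (h : IsCommutingPair P Q) {a b : ℝ} {U V : SO 4}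
    (he : (U.1)ᵀ * V.1 = NormedSpace.exp (a • P + b • Q)) :
    dist U V ^ 2 ≤ 2 * (a ^ 2 + b ^ 2) := by
  rw [← h.metric a b]
  exact (Real.le_sqrt (dist_nonneg _ _) (metric_self_nonneg _)).1 (dist_le_of_exp (h.skew a b) he)

theorem IsCommutingPair.isLUB_minimizing (h : IsCommutingPair P Q) {α β : ℝ} (hα : 0 ≤ α)
    (hβ : 0 ≤ β) (h1 : 2 * (α ^ 2 + β ^ 2) = 1) (U : SO 4) {t₀ : ℝ}
    (hlub : IsLUB {t : ℝ | 0 < t ∧ dist U (expCurve U (α • P + β • Q) (h.skew α β) t) = t} t₀) :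
    0 < t₀ ∧ t₀ * (α + β) = Real.pi := by
  have hpos : 0 < α + β := by
    by_contra h0
    have hα0 : α = 0 := by linarith
    have hβ0 : β = 0 := by linarith
    rw [hα0, hβ0] at h1
    norm_num at h1
  have hc : 0 < Real.pi / (α + β) := div_pos Real.pi_pos hpos
  have hexp : ∀ t, (U.1)ᵀ * (expCurve U (α • P + β • Q) (h.skew α β) t).1
      = NormedSpace.exp ((t * α) • P + (t * β) • Q) := fun t => by
    rw [transpose_mul_expCurve, smul_add, smul_smul, smul_smul]
  have hsq : ∀ t : ℝ, 2 * ((t * α) ^ 2 + (t * β) ^ 2) = t ^ 2 := fun t => by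
    linear_combination t ^ 2 * h1
  have ht₀ := (eq_of_isLUB_minimizing hc
    (f := fun t => dist U (expCurve U (α • P + β • Q) (h.skew α β) t)) (fun t ht htc => by
      rw [le_div_iff₀ hpos] at htc
      have hle := h.dist_sq_le (hexp t)
      have hge := h.le_dist_sq (mul_nonneg ht.le hα) (mul_nonneg ht.le hβ) (by linarith) (hexp t)
      rw [hsq] at hle hge
      exact (pow_left_inj₀ (dist_nonneg _ _) ht.le two_ne_zero).1 (le_antisymm hle hge))
    (fun t htc => by
      have ht : 0 < t := hc.trans htc
      rw [div_lt_iff₀ hpos] at htc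
      -- Shifting both angles by `π` changes two signs and hence nothing, and it shortens the
      -- generator exactly when the sum of the angles exceeds `π`.
      have he : NormedSpace.exp ((t * α) • P + (t * β) • Q)
          = NormedSpace.exp ((t * α - Real.pi) • P + (t * β - Real.pi) • Q) := by
        rw [h.exp, h.exp]
        simp only [Real.cos_sub_pi, Real.sin_sub_pi, neg_smul, ← neg_add, neg_mul_neg]
      have hle := h.dist_sq_le ((hexp t).trans he)
      refine lt_of_pow_lt_pow_left₀ 2 ht.le ?_
      have := hsq t
      nlinarith [Real.pi_pos])).1 hlub
  rw [ht₀]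
  exact ⟨hc, by field_simp⟩

end CommutingStructures

/-! ### Quaternions and reducibility for `p = 4`. -/

section Quaternions

/-- The matrix of the left multiplication by an imaginary quaternion. -/
def quatLeft (x : Fin 3 → ℝ) : Matrix (Fin 4) (Fin 4) ℝ :=
  !![0, -x 0, -x 1, -x 2; x 0, 0, -x 2, x 1; x 1, x 2, 0, -x 0; x 2, -x 1, x 0, 0]

/-- The matrix of the right multiplication by an imaginary quaternion. -/
def quatRight (x : Fin 3 → ℝ) : Matrix (Fin 4) (Fin 4) ℝ :=
  !![0, -x 0, -x 1, -x 2; x 0, 0, x 2, -x 1; x 1, -x 2, 0, x 0; x 2, x 1, -x 0, 0]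

theorem quatLeft_smul (c : ℝ) (x : Fin 3 → ℝ) : quatLeft (c • x) = c • quatLeft x := by
  ext i j
  fin_cases i <;> fin_cases j <;> simp [quatLeft]

theorem quatRight_smul (c : ℝ) (x : Fin 3 → ℝ) : quatRight (c • x) = c • quatRight x := by
  ext i j
  fin_cases i <;> fin_cases j <;> simp [quatRight]

theorem quatLeft_mul (x y : Fin 3 → ℝ) :
    quatLeft x * quatLeft y = -(x ⬝ᵥ y) • (1 : Matrix (Fin 4) (Fin 4) ℝ) + quatLeft (x ⨯₃ y) := by
  ext i j
  fin_cases i <;> fin_cases j <;>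
    simp [quatLeft, Matrix.mul_apply, Fin.sum_univ_four, dotProduct, Fin.sum_univ_three,
      cross_apply] <;> ring

theorem quatRight_mul (x y : Fin 3 → ℝ) : quatRight x * quatRight y
    = -(x ⬝ᵥ y) • (1 : Matrix (Fin 4) (Fin 4) ℝ) + quatRight (y ⨯₃ x) := by
  ext i j
  fin_cases i <;> fin_cases j <;>
    simp [quatRight, Matrix.mul_apply, Fin.sum_univ_four, dotProduct, Fin.sum_univ_three,
      cross_apply] <;> ring

theorem quatLeft_mul_quatRight (x y : Fin 3 → ℝ) :
    quatLeft x * quatRight y = quatRight y * quatLeft x := by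
  ext i j
  fin_cases i <;> fin_cases j <;>
    simp [quatLeft, quatRight, Matrix.mul_apply, Fin.sum_univ_four] <;> ring

theorem isCommutingPair_quat {x y : Fin 3 → ℝ} (hx : x ⬝ᵥ x = 1) (hy : y ⬝ᵥ y = 1) :
    IsCommutingPair (quatLeft x) (quatRight y) where
  left_skew := by ext i j; fin_cases i <;> fin_cases j <;> simp [quatLeft]
  right_skew := by ext i j; fin_cases i <;> fin_cases j <;> simp [quatRight]
  left_sq := by
    rw [quatLeft_mul, hx, cross_self, ← zero_smul ℝ (0 : Fin 3 → ℝ), quatLeft_smul]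
    simp
  right_sq := by
    rw [quatRight_mul, hy, cross_self, ← zero_smul ℝ (0 : Fin 3 → ℝ), quatRight_smul]
    simp
  comm := quatLeft_mul_quatRight x y
  trace_mul := by
    simp [Matrix.trace, quatLeft, quatRight, Fin.sum_univ_four]
    ring

theorem exists_unit_smul (x : Fin 3 → ℝ) :
    ∃ (r : ℝ) (m : Fin 3 → ℝ), 0 ≤ r ∧ m ⬝ᵥ m = 1 ∧ x = r • m := by
  by_cases h : x = 0
  · exact ⟨0, Pi.single 0 1, le_rfl, by simp, by rw [h, zero_smul]⟩
  · have hn : 0 ≤ x ⬝ᵥ x := Finset.sum_nonneg fun i _ => mul_self_nonneg _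
    have hpos : 0 < x ⬝ᵥ x := lt_of_le_of_ne hn fun h0 => h (dotProduct_self_eq_zero.1 h0.symm)
    have hs := Real.mul_self_sqrt hn
    have hs0 : √(x ⬝ᵥ x) ≠ 0 := (Real.sqrt_pos.2 hpos).ne'
    refine ⟨√(x ⬝ᵥ x), (√(x ⬝ᵥ x))⁻¹ • x, Real.sqrt_nonneg _, ?_, ?_⟩
    · rw [dotProduct_smul, smul_dotProduct, smul_eq_mul, smul_eq_mul]
      field_simp
      rw [sq, hs]
    · rw [smul_smul, mul_inv_cancel₀ hs0, one_smul]

/-- This is the splitting of antisymmetric `4 × 4` matrices into left and right multiplications by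
imaginary quaternions. -/
theorem exists_quat_decomposition {A : Matrix (Fin 4) (Fin 4) ℝ} (hA : Aᵀ = -A) :
    ∃ (α β : ℝ) (x y : Fin 3 → ℝ), 0 ≤ α ∧ 0 ≤ β ∧ x ⬝ᵥ x = 1 ∧ y ⬝ᵥ y = 1 ∧
      A = α • quatLeft x + β • quatRight y := by
  obtain ⟨α, x, hα, hx, hx'⟩ := exists_unit_smul
    ![(A 1 0 + A 3 2) / 2, (A 2 0 - A 3 1) / 2, (A 3 0 + A 2 1) / 2]
  obtain ⟨β, y, hβ, hy, hy'⟩ := exists_unit_smul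
    ![(A 1 0 - A 3 2) / 2, (A 2 0 + A 3 1) / 2, (A 3 0 - A 2 1) / 2]
  refine ⟨α, β, x, y, hα, hβ, hx, hy, ?_⟩
  rw [← quatLeft_smul, ← quatRight_smul, ← hx', ← hy']
  have h00 := skew_diag hA 0
  have h11 := skew_diag hA 1
  have h22 := skew_diag hA 2
  have h33 := skew_diag hA 3
  have h01 := skew_apply hA 0 1
  have h02 := skew_apply hA 0 2
  have h03 := skew_apply hA 0 3
  have h12 := skew_apply hA 1 2
  have h13 := skew_apply hA 1 3
  have h23 := skew_apply hA 2 3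
  ext i j
  fin_cases i <;> fin_cases j <;>
    simp [quatLeft, quatRight, h00, h11, h22, h33, h01, h02, h03, h12, h13, h23] <;> ring

theorem abs_dotProduct_le_one {x y : Fin 3 → ℝ} (hx : x ⬝ᵥ x = 1) (hy : y ⬝ᵥ y = 1) :
    -1 ≤ x ⬝ᵥ y ∧ x ⬝ᵥ y ≤ 1 := by
  have h := Finset.sum_mul_sq_le_sq_mul_sq Finset.univ x y
  simp only [dotProduct, ← sq] at hx hy ⊢
  rw [hx, hy] at h
  exact abs_le.1 ((sq_le_one_iff_abs_le_one _).1 (by linarith))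

/-- It puts the product of two imaginary units, with real part `-(x ⬝ᵥ y)` and imaginary part `x ⨯₃
y` up to order, into the form `cos a + sin a m`. -/
theorem exists_cross_eq {x y : Fin 3 → ℝ} (hx : x ⬝ᵥ x = 1) (hy : y ⬝ᵥ y = 1) :
    ∃ m : Fin 3 → ℝ, m ⬝ᵥ m = 1 ∧ x ⨯₃ y = Real.sin (Real.arccos (-(x ⬝ᵥ y))) • m := by
  obtain ⟨r, m, hr, hm, he⟩ := exists_unit_smul (x ⨯₃ y)
  have h := cross_dot_cross x y x y
  rw [he, dotProduct_smul, smul_dotProduct, hm, hx, hy, dotProduct_comm y x] at h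
  simp only [smul_eq_mul] at h
  refine ⟨m, hm, ?_⟩
  rw [he, Real.sin_arccos, show 1 - (-(x ⬝ᵥ y)) ^ 2 = r ^ 2 by linarith, Real.sqrt_sq hr]

theorem exists_exp_eq_quat_products {e x y : Fin 3 → ℝ} (he : e ⬝ᵥ e = 1) (hx : x ⬝ᵥ x = 1)
    (hy : y ⬝ᵥ y = 1) (hex : e ⬝ᵥ x < 0) (hey : e ⬝ᵥ y ≤ 0) :
    ∃ B : Matrix (Fin 4) (Fin 4) ℝ, Bᵀ = -B ∧ metric B B < Real.pi ^ 2 ∧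
      quatLeft e * quatRight e * (quatLeft x * quatRight y) = NormedSpace.exp B := by
  obtain ⟨m, hm, hm'⟩ := exists_cross_eq he hx
  obtain ⟨n, hn, hn'⟩ := exists_cross_eq hy he
  rw [dotProduct_comm y e] at hn'
  have h := isCommutingPair_quat hm hn
  have hbx := abs_dotProduct_le_one he hx
  have hby := abs_dotProduct_le_one he hy
  set a := Real.arccos (-(e ⬝ᵥ x)) with ha
  set b := Real.arccos (-(e ⬝ᵥ y)) with hb
  have ha0 : 0 ≤ a := Real.arccos_nonneg _
  have hb0 : 0 ≤ b := Real.arccos_nonneg _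
  have ha2 : a < Real.pi / 2 := Real.arccos_lt_pi_div_two.2 (by linarith)
  have hb2 : b ≤ Real.pi / 2 := Real.arccos_le_pi_div_two.2 (by linarith)
  -- One angle is strictly below `π / 2` and the other at most `π / 2`, so `2 (a ^ 2 + b ^ 2) < π ^
  -- 2`.
  refine ⟨a • quatLeft m + b • quatRight n, h.skew a b, ?_, ?_⟩
  · rw [h.metric]
    nlinarith
  · rw [h.exp, ha, hb, Real.cos_arccos (by linarith) (by linarith),
      Real.cos_arccos (by linarith) (by linarith), ← ha, ← hb, ← quatLeft_smul, ← quatRight_smul,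
      ← hm', ← hn', ← quatLeft_mul, ← quatRight_mul, mul_assoc, ← mul_assoc (quatRight e),
      ← quatLeft_mul_quatRight]
    simp only [mul_assoc]

/-- The signs of the coordinates of `q ↦ e q e` for an imaginary quaternion unit `e`. -/
def quatSign (i : Fin 3) (k : Fin 4) : ℝ := if k = 0 ∨ k = i.succ then -1 else 1

theorem quatLeft_single_mul_quatRight_single (i : Fin 3) :
    quatLeft (Pi.single i 1) * quatRight (Pi.single i 1) = Matrix.diagonal (quatSign i) := by
  ext a b
  fin_cases i <;> fin_cases a <;> fin_cases b <;>
    simp [quatLeft, quatRight, Matrix.mul_apply, Fin.sum_univ_four, quatSign, Fin.ext_iff]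

theorem prod_quatSign (i : Fin 3) : ∏ k, quatSign i k = 1 := by
  simp only [Fin.prod_univ_four, quatSign]
  fin_cases i <;> simp

theorem exists_sign_dotProduct_nonpos (e y : Fin 3 → ℝ) (hy : y ⬝ᵥ y = 1) :
    ∃ ε : ℝ, (ε = 1 ∨ ε = -1) ∧ (ε • y) ⬝ᵥ (ε • y) = 1 ∧ e ⬝ᵥ (ε • y) = -|e ⬝ᵥ y| := by
  rcases le_total 0 (e ⬝ᵥ y) with h | h
  · exact ⟨-1, Or.inr rfl, by simpa using hy, by rw [abs_of_nonneg h]; simp⟩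
  · exact ⟨1, Or.inl rfl, by simpa using hy, by rw [abs_of_nonpos h]; simp⟩

theorem reducible_four {U V : SO 4} (h : GeodesicallyAntipodal U V) : SignChangeReducible U V := by
  obtain ⟨A, t, hA, h1, ⟨α, β, P, Q, hP, hα, hβ, rfl, hx, ht, htπ⟩, he⟩ := h.exists_cutTime
    (c := fun A t => ∃ α β : ℝ, ∃ x y : Fin 3 → ℝ, (x ⬝ᵥ x = 1 ∧ y ⬝ᵥ y = 1) ∧ 0 ≤ α ∧ 0 ≤ β ∧
      A = α • quatLeft x + β • quatRight y ∧ 2 * (α ^ 2 + β ^ 2) = 1 ∧ 0 < t ∧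
      t * (α + β) = Real.pi)
    (fun U A hA t h1 hlub => by
      obtain ⟨α, β, x, y, hα, hβ, hx, hy, rfl⟩ := exists_quat_decomposition hA
      have hpair := isCommutingPair_quat hx hy
      rw [hpair.metric] at h1
      exact ⟨α, β, x, y, ⟨hx, hy⟩, hα, hβ, rfl, h1, hpair.isLUB_minimizing hα hβ h1 U hlub⟩)
    (fun A t ⟨α, β, x, y, ⟨hx, hy⟩, hα, hβ, hA, h1, h2⟩ =>
      ⟨α, β, (-1 : ℝ) • x, (-1 : ℝ) • y, ⟨by simpa using hx, by simpa using hy⟩, hα, hβ, by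
        rw [hA, quatLeft_smul, quatRight_smul]; module, h1, h2⟩)
  obtain ⟨hx, hy⟩ := hP
  have hpair := isCommutingPair_quat hx hy
  rw [smul_add, smul_smul, smul_smul] at he
  obtain ⟨a, ha⟩ : ∃ a, a = t * α := ⟨_, rfl⟩
  obtain ⟨b, hb⟩ : ∃ b, b = t * β := ⟨_, rfl⟩
  have ha0 : 0 ≤ a := ha ▸ mul_nonneg ht.le hα
  have hb0 : 0 ≤ b := hb ▸ mul_nonneg ht.le hβ
  have hab : a + b = Real.pi := by rw [ha, hb, ← mul_add, htπ]
  rw [← ha, ← hb] at he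
  have hd := hpair.le_dist_sq ha0 hb0 hab.le he
  have hneg : Matrix.diagonal (fun _ : Fin 4 => (-1 : ℝ)) = -1 := by
    rw [← Matrix.diagonal_one, Matrix.diagonal_neg]
  rcases lt_trichotomy a b with hlt | heq | hlt
  -- The sign change `-1` replaces `b` by `b - π = -a`, smaller in absolute value than `b`.
  · refine reducible_of_exp (σ := fun _ => -1) (fun _ => Or.inr rfl)
      (by norm_num [Fin.prod_univ_four]) (hpair.skew a (b - Real.pi)) ?_ ?_
    · rw [he, hneg, hpair.exp, hpair.exp, Real.cos_sub_pi, Real.sin_sub_pi, neg_smul, neg_smul,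
        ← neg_add, mul_neg, neg_one_mul]
    · rw [hpair.metric]
      nlinarith
  · have ha2 : a = Real.pi / 2 := by linarith
    have hb2 : b = Real.pi / 2 := by linarith
    have hW : (U.1)ᵀ * V.1 = quatLeft P * quatRight Q := by
      rw [he, hpair.exp, ha2, hb2, Real.cos_pi_div_two, Real.sin_pi_div_two]
      simp
    have hd' : Real.pi ^ 2 ≤ dist U V ^ 2 := by rw [ha2, hb2] at hd; linarith
    -- Here `Uᵀ V` is `q ↦ x q y` for imaginary units `x = P`, `y = Q`, at squared distance at least
    -- `π ^ 2`. A coordinate unit not orthogonal to `P` gives the strict inequality; the signs `ε`,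
    -- `δ` orient `P` and `Q` and are absorbed into the sign change.
    obtain ⟨i, hi⟩ : ∃ i, P i ≠ 0 := by
      by_contra! h0
      rw [show P = 0 from funext h0] at hx
      simp at hx
    obtain ⟨ε, hε, hεx, hεe⟩ := exists_sign_dotProduct_nonpos (Pi.single i (1 : ℝ)) P hx
    obtain ⟨δ, hδ, hδy, hδe⟩ := exists_sign_dotProduct_nonpos (Pi.single i (1 : ℝ)) Q hy
    obtain ⟨B, hB, hBlt, hBe⟩ := exists_exp_eq_quat_products
      (e := Pi.single i (1 : ℝ)) (by simp) hεx hδy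
      (by rw [hεe]; simpa using hi) (by rw [hδe]; simp)
    refine reducible_of_exp (σ := fun k => ε * δ * quatSign i k) (fun k => ?_) ?_ hB ?_
      (hBlt.trans_le hd')
    · simp only [quatSign]
      rcases hε with rfl | rfl <;> rcases hδ with rfl | rfl <;> split_ifs <;> norm_num
    · rw [Finset.prod_mul_distrib, prod_quatSign]
      rcases hε with rfl | rfl <;> rcases hδ with rfl | rfl <;> norm_num
    · have hdiag : Matrix.diagonal (fun k => ε * δ * quatSign i k)
          = (ε * δ) • Matrix.diagonal (quatSign i) := by
        rw [← Matrix.diagonal_smul]; rfl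
      rw [hW, hdiag, ← hBe, quatLeft_smul, quatRight_smul, smul_mul_smul_comm,
        quatLeft_single_mul_quatRight_single, smul_mul_assoc, mul_smul_comm]
  · refine reducible_of_exp (σ := fun _ => -1) (fun _ => Or.inr rfl)
      (by norm_num [Fin.prod_univ_four]) (hpair.skew (a - Real.pi) b) ?_ ?_
    · rw [he, hneg, hpair.exp, hpair.exp, Real.cos_sub_pi, Real.sin_sub_pi, neg_smul, neg_smul,
        ← neg_add, neg_mul, neg_mul, one_mul]
    · rw [hpair.metric]
      nlinarith

end Quaternions

end SignChange

theorem mainTheorem1 (p : ℕ) :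
    (p ≤ 4 → ∀ U V : SignChange.SO p,
      SignChange.GeodesicallyAntipodal U V → SignChange.SignChangeReducible U V) ∧
    (11 ≤ p → ∃ U V : SignChange.SO p,
      SignChange.GeodesicallyAntipodal U V ∧ ¬ SignChange.SignChangeReducible U V) := by
  refine ⟨fun hp U V h => ?_, SignChange.exists_antipodal_not_reducible⟩
  by_cases h2 : p < 2
  · exact absurd h (SignChange.not_antipodal_of_lt_two h2 U V)
  · obtain rfl | rfl | rfl : p = 2 ∨ p = 3 ∨ p = 4 := by omega
    · exact SignChange.reducible_two h
    · exact SignChange.reducible_three h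
    · exact SignChange.reducible_four h
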